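/- Let $K$ be a field of characteristic different from $2$; all algebras are commutative $K$-algebras, not assumed associative. Put $a^1=a$ and $a^{k+1}=a^k a$. An algebra $N$ is an evolution algebra if it has a finite natural basis, that is, a basis $(e_i)$ with $e_ie_j=0$ for $i\neq j$; it is nil if every $a\in N$ satisfies $a^k=0$ for some $k\geq 1$; it is power-associative if $x^ix^j=x^{i+j}$ for all $x\in N$ and $i,j\geq 1$; it is indecomposable if it is not the direct sum of two nonzero ideals. Its annihilator is $\operatorname{ann}(N)=\{x\in N: xN=0\}$, and $D(N)$ denotes the Lie algebra of derivations of $N$, i.e. of linear maps $d$ with $d(xy)=d(x)y+x\,d(y)$. For $\alpha\in K^*$ let $N_{6,25}(\alpha)$ be the evolution algebra with natural basis $e_1,\dots,e_6$ and $$e_1^2=e_2+e_3,\quad e_2^2=e_5,\quad e_3^2=-e_5,\quad e_4^2=\alpha(e_2+e_3)+e_6,\quad e_5^2=e_6^2=0,$$ and let $N_{6,26}$ be the evolution algebra with natural basis $e_1,\dots,e_6$ and $$e_1^2=e_2+e_3+e_4,\quad e_2^2=e_5,\quad e_3^2=e_6,\quad e_4^2=-(e_5+e_6),\quad e_5^2=e_6^2=0.$$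 **Theorem.** The algebras $N_{6,25}(\alpha)$ ($\alpha\in K^*$) and $N_{6,26}$ are indecomposable, power-associative, non-associative evolution nilalgebras of dimension $\leq 6$ with annihilator of dimension $2$, and every algebra with these properties is isomorphic to $N_{6,25}(\alpha)$ for some $\alpha\in K^*$ or to $N_{6,26}$. Their derivations are as follows. 1. A linear map $d$ of $N_{6,25}(\alpha)$ is a derivation if and only if there are $d_{11},d_{22},d_{51},d_{61},d_{52},d_{62},d_{54},d_{64}\in K$ with $$\begin{aligned} d(e_1)&=d_{11}e_1+d_{51}e_5+d_{61}e_6,\\ d(e_2)&=d_{22}e_2+(2d_{11}-d_{22})e_3+d_{52}e_5+d_{62}e_6,\\ d(e_3)&=(2d_{11}-d_{22})e_2+d_{22}e_3-d_{52}e_5-d_{62}e_6,\\ d(e_4)&=d_{11}e_4+d_{54}e_5+d_{64}e_6,\\ d(e_5)&=2d_{22}e_5,\qquad d(e_6)=2d_{11}e_6,\end{aligned}$$ and $D(N_{6,25}(\alpha))\simeq K^5\times K^3$ as a vector space. 2. A linear map $d$ of $N_{6,26}$ is a derivation if and only if there are $d_{11},d_{51},d_{61},d_{52},d_{62},d_{53},d_{63}\in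 K$ with $$\begin{aligned} d(e_1)&=d_{11}e_1+d_{51}e_5+d_{61}e_6,\\ d(e_2)&=2d_{11}e_2+d_{52}e_5+d_{62}e_6,\\ d(e_3)&=2d_{11}e_3+d_{53}e_5+d_{63}e_6,\\ d(e_4)&=2d_{11}e_4-(d_{52}+d_{53})e_5-(d_{62}+d_{63})e_6,\\ d(e_5)&=4d_{11}e_5,\qquad d(e_6)=4d_{11}e_6,\end{aligned}$$ and $D(N_{6,26})\simeq K^4\times K^3$ as a vector space. -/

import Mathlib

-- The commutator bracket on `Module.End K N`.
attribute [local instance] LieRing.ofAssociativeRing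

namespace EvolutionNil

section Notions

variable (K : Type*) [Field K]
variable (N : Type*) [NonUnitalNonAssocCommRing N] [Module K N]

/-- A (finite-dimensional) evolution algebra: it has a natural basis `b`, that is, a finite basis
with `b i * b j = 0` whenever `i ≠ j`. -/
def IsEvolutionAlgebra : Prop :=
  ∃ (n : ℕ) (b : Module.Basis (Fin n) K N), ∀ i j, i ≠ j → b i * b j = 0

variable {N} in
/-- Principal powers, indexed from `0`: `principalPow a k` is `a ^ (k + 1)`, where `a ^ 1 = a` and
`a ^ (k + 1) = a ^ k * a`. -/
def principalPow (a : N) : ℕ → N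
  | 0 => a
  | k + 1 => principalPow a k * a

/-- Every element has a vanishing principal power. -/
def IsNilAlgebra : Prop :=
  ∀ a : N, ∃ k : ℕ, principalPow a k = 0

/-- `x ^ i * x ^ j = x ^ (i + j)` for all `x` and all `i, j ≥ 1`
(exponents are shifted by one in `principalPow`). -/
def IsPowerAssociative : Prop :=
  ∀ (x : N) (i j : ℕ), principalPow x i * principalPow x j = principalPow x (i + j + 1)

/-- Associativity of the multiplication. -/
def IsAssociativeAlgebra : Prop :=
  ∀ x y z : N, x * y * z = x * (y * z)

variable {K N} in
/-- Ideals of a commutative algebra: subspaces stable under multiplication by all elements. -/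
def IsAlgebraIdeal (I : Submodule K N) : Prop :=
  ∀ x ∈ I, ∀ y : N, x * y ∈ I

/-- The algebra is the direct sum of two nonzero ideals. -/
def IsDecomposable : Prop :=
  ∃ I J : Submodule K N,
    IsAlgebraIdeal I ∧ IsAlgebraIdeal J ∧ I ≠ ⊥ ∧ J ≠ ⊥ ∧ IsCompl I J

/-- The annihilator `{x | x N = 0}`. -/
def annihilator [IsScalarTower K N N] : Submodule K N where
  carrier := {x | ∀ y : N, x * y = 0}
  add_mem' := by
    intro a b ha hb y
    rw [add_mul, ha y, hb y, add_zero]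
  zero_mem' := by
    intro y
    exact zero_mul y
  smul_mem' := by
    intro c x hx y
    rw [smul_mul_assoc, hx y, smul_zero]

/-- The Lie algebra of derivations: the linear maps `d` with `d (x y) = d(x) y + x d(y)`, with the
commutator bracket. -/
def derivationAlgebra [IsScalarTower K N N] [SMulCommClass K N N] :
    LieSubalgebra K (Module.End K N) where
  carrier := {d | ∀ x y : N, d (x * y) = d x * y + x * d y}
  add_mem' := by
    intro d d' hd hd' x y
    simp only [LinearMap.add_apply, hd x y, hd' x y, add_mul, mul_add]
    abel
  zero_mem' := by
    intro x y
    simp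
  smul_mem' := by
    intro c d hd x y
    simp only [LinearMap.smul_apply, hd x y, smul_add, smul_mul_assoc, mul_smul_comm]
  lie_mem' := by
    intro d d' hd hd' x y
    simp only [Set.mem_ofPred_eq] at hd hd'
    simp only [Ring.lie_def, LinearMap.sub_apply, Module.End.mul_apply, hd, hd', map_add,
      sub_mul, mul_sub]
    abel

/-- The class of algebras under study: indecomposable, power-associative, non-associative evolution
nilalgebras of dimension at most `6` whose annihilator has dimension `2`. -/
structure InClass [IsScalarTower K N N] : Prop where
  evolution : IsEvolutionAlgebra K N
  nil : IsNilAlgebra N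
  powerAssociative : IsPowerAssociative N
  notAssociative : ¬ IsAssociativeAlgebra N
  indecomposable : ¬ IsDecomposable K N
  dim_le : Module.finrank K N ≤ 6
  dim_annihilator : Module.finrank K (annihilator K N) = 2

/-- Isomorphism of `K`-algebras. -/
def AlgebraIsomorphic (N' : Type*) [NonUnitalNonAssocCommRing N'] [Module K N'] : Prop :=
  ∃ f : N ≃ₗ[K] N', ∀ x y : N, f (x * y) = f x * f y

end Notions

section Construction

variable {K : Type*} [Field K] {n : ℕ}

/-- The evolution algebra with structure matrix `M`: the space `K ^ n` with the multiplication for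
which the standard basis satisfies `e i * e j = 0` for `i ≠ j` and `e i * e i = ∑ k, M i k • e k`. -/
def EvolutionAlgebra (_M : Matrix (Fin n) (Fin n) K) : Type _ := Fin n → K

namespace EvolutionAlgebra

variable (M : Matrix (Fin n) (Fin n) K)

instance : AddCommGroup (EvolutionAlgebra M) := inferInstanceAs (AddCommGroup (Fin n → K))

instance : Module K (EvolutionAlgebra M) := inferInstanceAs (Module K (Fin n → K))

instance : Mul (EvolutionAlgebra M) :=
  ⟨fun x y => fun k => ∑ i, x i * y i * M i k⟩

variable {M} in
protected theorem mul_apply (x y : EvolutionAlgebra M) (k : Fin n) :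
    (x * y) k = ∑ i, x i * y i * M i k := rfl

variable {M} in
protected theorem add_apply (x y : EvolutionAlgebra M) (k : Fin n) : (x + y) k = x k + y k := rfl

variable {M} in
protected theorem smul_apply (c : K) (x : EvolutionAlgebra M) (k : Fin n) : (c • x) k = c * x k := rfl

variable {M} in
protected theorem zero_apply (k : Fin n) : (0 : EvolutionAlgebra M) k = 0 := rfl

instance : NonUnitalNonAssocCommRing (EvolutionAlgebra M) where
  __ := (inferInstance : AddCommGroup (EvolutionAlgebra M))
  __ := (inferInstance : Mul (EvolutionAlgebra M))
  left_distrib := by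
    intro a b c
    funext k
    simp only [EvolutionAlgebra.mul_apply, EvolutionAlgebra.add_apply, mul_add, add_mul, Finset.sum_add_distrib]
  right_distrib := by
    intro a b c
    funext k
    simp only [EvolutionAlgebra.mul_apply, EvolutionAlgebra.add_apply, add_mul, Finset.sum_add_distrib]
  zero_mul := by
    intro a
    funext k
    simp only [EvolutionAlgebra.mul_apply, EvolutionAlgebra.zero_apply, zero_mul, Finset.sum_const_zero]
  mul_zero := by
    intro a
    funext k
    simp only [EvolutionAlgebra.mul_apply, EvolutionAlgebra.zero_apply, mul_zero, zero_mul, Finset.sum_const_zero]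
  mul_comm := by
    intro a b
    funext k
    simp only [EvolutionAlgebra.mul_apply, mul_comm]

instance : IsScalarTower K (EvolutionAlgebra M) (EvolutionAlgebra M) where
  smul_assoc := by
    intro c x y
    funext k
    simp only [smul_eq_mul, EvolutionAlgebra.mul_apply, EvolutionAlgebra.smul_apply, Finset.mul_sum, mul_assoc]

instance : SMulCommClass K (EvolutionAlgebra M) (EvolutionAlgebra M) where
  smul_comm := by
    intro c x y
    simp only [smul_eq_mul]
    rw [mul_comm x (c • y), smul_mul_assoc, mul_comm]

/-- The standard natural basis vectors. -/
def e (i : Fin n) : EvolutionAlgebra M := Pi.single i (1 : K)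

theorem e_apply (i k : Fin n) : e M i k = if k = i then 1 else 0 := Pi.single_apply i 1 k

theorem e_mul_e_of_ne {i j : Fin n} (h : i ≠ j) : e M i * e M j = 0 := by
  funext k
  rw [EvolutionAlgebra.mul_apply, EvolutionAlgebra.zero_apply]
  refine Finset.sum_eq_zero fun l _ => ?_
  by_cases hl : l = i
  · subst hl
    simp [e, Pi.single_eq_of_ne h]
  · simp [e, Pi.single_eq_of_ne hl]

theorem e_mul_self (i : Fin n) : e M i * e M i = M i := by
  funext k
  rw [EvolutionAlgebra.mul_apply, Finset.sum_eq_single i]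
  · simp [e]
  · intro l _ hl
    simp [e, Pi.single_eq_of_ne hl]
  · simp

end EvolutionAlgebra

/-- Structure matrix of `N_{6,25}(α)`. Row `i` holds the coordinates of the square of the `i`-th
basis vector: `e₁² = e₂ + e₃`, `e₂² = e₅`, `e₃² = -e₅`, `e₄² = α (e₂ + e₃) + e₆`,
`e₅² = e₆² = 0`. -/
def structureMatrix625 (α : K) : Matrix (Fin 6) (Fin 6) K :=
  !![0, 1, 1, 0, 0, 0;
     0, 0, 0, 0, 1, 0;
     0, 0, 0, 0, -1, 0;
     0, α, α, 0, 0, 1;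
     0, 0, 0, 0, 0, 0;
     0, 0, 0, 0, 0, 0]

variable (K) in
/-- Structure matrix of `N_{6,26}`: `e₁² = e₂ + e₃ + e₄`, `e₂² = e₅`, `e₃² = e₆`,
`e₄² = -(e₅ + e₆)`, `e₅² = e₆² = 0`. -/
def structureMatrix626 : Matrix (Fin 6) (Fin 6) K :=
  !![0, 1, 1, 1, 0, 0;
     0, 0, 0, 0, 1, 0;
     0, 0, 0, 0, 0, 1;
     0, 0, 0, 0, -1, -1;
     0, 0, 0, 0, 0, 0;
     0, 0, 0, 0, 0, 0]

/-- The algebra `N_{6,25}(α)`. -/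
abbrev N625 (α : K) : Type _ := EvolutionAlgebra (structureMatrix625 α)

variable (K) in
/-- The algebra `N_{6,26}`. -/
abbrev N626 : Type _ := EvolutionAlgebra (structureMatrix626 K)

end Construction

section DerivationTables

/-! In the two tables the vectors `e₁, …, e₆` are `e 0, …, e 5`, and `d_ji` denotes the coefficient
of `e_j` in `d (e_i)`. -/

variable {K : Type*} [Field K] {V : Type*} [AddCommGroup V] [Module K V]

/-- The linear map `d` has the form listed for `N_{6,25}(α)` on the vectors `e`. -/
def HasForm625 (e : Fin 6 → V) (d : Module.End K V) : Prop :=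
  ∃ d11 d22 d51 d61 d52 d62 d54 d64 : K,
    d (e 0) = d11 • e 0 + d51 • e 4 + d61 • e 5 ∧
    d (e 1) = d22 • e 1 + (2 * d11 - d22) • e 2 + d52 • e 4 + d62 • e 5 ∧
    d (e 2) = (2 * d11 - d22) • e 1 + d22 • e 2 - d52 • e 4 - d62 • e 5 ∧
    d (e 3) = d11 • e 3 + d54 • e 4 + d64 • e 5 ∧
    d (e 4) = (2 * d22) • e 4 ∧
    d (e 5) = (2 * d11) • e 5

/-- The linear map `d` has the form listed for `N_{6,26}` on the vectors `e`. -/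
def HasForm626 (e : Fin 6 → V) (d : Module.End K V) : Prop :=
  ∃ d11 d51 d61 d52 d62 d53 d63 : K,
    d (e 0) = d11 • e 0 + d51 • e 4 + d61 • e 5 ∧
    d (e 1) = (2 * d11) • e 1 + d52 • e 4 + d62 • e 5 ∧
    d (e 2) = (2 * d11) • e 2 + d53 • e 4 + d63 • e 5 ∧
    d (e 3) = (2 * d11) • e 3 - (d52 + d53) • e 4 - (d62 + d63) • e 5 ∧
    d (e 4) = (4 * d11) • e 4 ∧
    d (e 5) = (4 * d11) • e 5

end DerivationTables

end EvolutionNil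

/-! Write a_ij for the coefficient of b_j in b_i², where b is a natural basis. Nilpotency gives a_ii
= 0 and a_ij a_ji = 0, because an element whose fourth power is a multiple of its square kills that
multiple. Power-associativity, via x²x² = x⁴ and characteristic not 2, gives N²N² = 0
(`mul_mul_mul_eq_zero`), hence x⁴ = 0. Polarizing x⁴ = 0 shows that b_q² lies in the annihilator as
soon as some b_p² involves b_q (`repr_sq_eq_zero`).

Indecomposability enters through `annihilator_le_of_mul_mem`: an annihilating vector outside N²
would split off as a one-dimensional ideal, so ann(N) ⊆ N².

Non-associativity provides b_i² involving some b_k with b_k² ≠ 0. Since b_i²b_i² = Σ a_ij² b_j² = 0,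
a second such vector b_l occurs. With only i, k, l non-annihilating, N would be spanned by four
vectors although its dimension is at least 5; so there is a fourth, m, and the dimension is 6
(`exists_adapted_basis`). If b_i² involves b_m too, rescaling gives N_{6,26}. Otherwise N²N² = 0
makes b_m² equal to α b_i² modulo the annihilator, which gives N_{6,25}(α); α = 0 is excluded since
that algebra decomposes.

For the two models all products of degree four vanish, and derivations are found by solving the
Leibniz rule on pairs of basis vectors. -/

namespace EvolutionNil

/-! ### Consequences of nilpotency for elements with a recurrent power. -/

section Nil

variable {N : Type*} [NonUnitalNonAssocCommRing N]

theorem principalPow_succ (a : N) (k : ℕ) : principalPow a (k + 1) = principalPow a k * a := rfl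

theorem principalPow_eq_zero_of_le {a : N} {k l : ℕ} (h : principalPow a k = 0) (hkl : k ≤ l) :
    principalPow a l = 0 := by
  induction l, hkl using Nat.le_induction with
  | base => exact h
  | succ l _ ih => rw [principalPow_succ, ih, zero_mul]

variable {K : Type*} [Field K] [Module K N] [IsScalarTower K N N]

/-- The relation iterates to xᵏ⁺² = cᵏ x², and some power of x vanishes, so c = 0 or x² = 0. -/
theorem smul_sq_eq_zero_of_cube_eq (hnil : IsNilAlgebra N) {x : N} {c : K}
    (h : x * x * x = c • (x * x)) : c • (x * x) = 0 := by
  have key : ∀ k : ℕ, principalPow x (k + 1) = c ^ k • (x * x) := by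
    intro k
    induction k with
    | zero => simp [principalPow]
    | succ k ih => rw [principalPow_succ, ih, smul_mul_assoc, h, smul_smul, pow_succ]
  obtain ⟨k, hk⟩ := hnil x
  have := principalPow_eq_zero_of_le hk (Nat.le_succ k)
  rw [key, smul_eq_zero] at this
  rcases this with h0 | h0
  · rw [eq_zero_of_pow_eq_zero h0, zero_smul]
  · rw [h0, smul_zero]

theorem smul_sq_eq_zero_of_fourth_eq (hnil : IsNilAlgebra N) {x : N} {c : K}
    (h : x * x * x * x = c • (x * x)) : c • (x * x) = 0 := by
  -- Exponents are shifted by one: this is x²ᵏ⁺² = cᵏ x².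
  have key : ∀ k : ℕ, principalPow x (2 * k + 1) = c ^ k • (x * x) := by
    intro k
    induction k with
    | zero => simp [principalPow]
    | succ k ih =>
      rw [show 2 * (k + 1) + 1 = 2 * k + 1 + 1 + 1 by ring, principalPow_succ, principalPow_succ,
        ih, smul_mul_assoc, smul_mul_assoc, h, smul_smul, pow_succ]
  obtain ⟨k, hk⟩ := hnil x
  have := principalPow_eq_zero_of_le hk (show k ≤ 2 * k + 1 by omega)
  rw [key, smul_eq_zero] at this
  rcases this with h0 | h0
  · rw [eq_zero_of_pow_eq_zero h0, zero_smul]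
  · rw [h0, smul_zero]

end Nil

theorem eq_zero_of_add_self {K : Type*} [Field K] {N : Type*} [AddCommGroup N] [Module K N]
    (h2 : (2 : K) ≠ 0) {x : N} (h : x + x = 0) : x = 0 := by
  rw [← two_smul K x] at h
  exact (smul_eq_zero.1 h).resolve_left h2

theorem sq_add_basis {N ι : Type*} [NonUnitalNonAssocCommRing N] {b : ι → N}
    (hb : ∀ i j, i ≠ j → b i * b j = 0) {i j : ι} (hij : i ≠ j) :
    (b i + b j) * (b i + b j) = b i * b i + b j * b j := by
  rw [add_mul, mul_add, mul_add, hb i j hij, hb j i hij.symm, add_zero, zero_add]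

/-! ### Structure constants of a nil evolution algebra and its annihilator. -/

section NaturalBasis

variable {K : Type*} [Field K] {N : Type*} [NonUnitalNonAssocCommRing N] [Module K N]
  [IsScalarTower K N N] {ι : Type*} [Fintype ι]
  {b : Module.Basis ι K N}

theorem mul_basis (hb : ∀ i j, i ≠ j → b i * b j = 0) (x : N) (i : ι) :
    x * b i = b.repr x i • (b i * b i) := by
  conv_lhs => rw [← b.sum_repr x, Finset.sum_mul]
  rw [Finset.sum_eq_single i]
  · rw [smul_mul_assoc]
  · intro j _ hj
    rw [smul_mul_assoc, hb j i hj, smul_zero]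
  · simp

/-- The diagonal structure constants of a nil evolution algebra vanish. -/
theorem repr_sq_self (hb : ∀ i j, i ≠ j → b i * b j = 0) (hnil : IsNilAlgebra N) (i : ι) :
    b.repr (b i * b i) i = 0 := by
  have h := smul_sq_eq_zero_of_cube_eq hnil (mul_basis hb (b i * b i) i)
  rcases smul_eq_zero.1 h with h | h
  · exact h
  · rw [h]; simp

theorem fourth_pow_add (hb : ∀ i j, i ≠ j → b i * b j = 0) (hnil : IsNilAlgebra N) {i j : ι}
    (hij : i ≠ j) : (b i + b j) * (b i + b j) * (b i + b j) * (b i + b j) =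
      (b.repr (b i * b i) j * b.repr (b j * b j) i) • ((b i + b j) * (b i + b j)) := by
  have e2 : b i * b i * b i = 0 := by rw [mul_basis hb, repr_sq_self hb hnil, zero_smul]
  have e3 : b j * b j * b j = 0 := by rw [mul_basis hb, repr_sq_self hb hnil, zero_smul]
  have e4 := mul_basis hb (b i * b i) j
  have e5 := mul_basis hb (b j * b j) i
  rw [sq_add_basis hb hij]
  simp only [mul_add, add_mul, e2, e3, e4, e5, smul_mul_assoc, smul_zero, smul_add, smul_smul,
    add_zero, zero_add]
  rw [mul_comm (b.repr (b j * b j) i)]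

/-- For x = b_i + b_j, x⁴ = a_ij a_ji x², so either the product of constants or x² is zero. In the
latter case b_i² = -b_j², whose coefficient at j vanishes. -/
theorem repr_sq_mul_repr_sq (hb : ∀ i j, i ≠ j → b i * b j = 0) (hnil : IsNilAlgebra N) (i j : ι) :
    b.repr (b i * b i) j * b.repr (b j * b j) i = 0 := by
  by_cases hij : i = j
  · rw [hij, repr_sq_self hb hnil, zero_mul]
  have h := smul_sq_eq_zero_of_fourth_eq hnil (fourth_pow_add hb hnil hij)
  rcases smul_eq_zero.1 h with h | h
  · exact h
  · rw [sq_add_basis hb hij] at h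
    rw [eq_neg_of_add_eq_zero_left h, map_neg, Finsupp.neg_apply, repr_sq_self hb hnil, neg_zero,
      zero_mul]


variable [SMulCommClass K N N]

theorem mul_eq_sum (hb : ∀ i j, i ≠ j → b i * b j = 0) (x y : N) :
    x * y = ∑ i, (b.repr x i * b.repr y i) • (b i * b i) := by
  conv_lhs => rw [← b.sum_repr y, Finset.mul_sum]
  refine Finset.sum_congr rfl fun i _ => ?_
  rw [mul_smul_comm, mul_basis hb, smul_smul, mul_comm]

theorem mem_annihilator_iff (hb : ∀ i j, i ≠ j → b i * b j = 0) (x : N) :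
    x ∈ annihilator K N ↔ ∀ i, b i * b i ≠ 0 → b.repr x i = 0 := by
  constructor
  · intro hx i hi
    have := hx (b i)
    rw [mul_basis hb, smul_eq_zero] at this
    exact this.resolve_right hi
  · intro h y
    rw [mul_eq_sum hb]
    refine Finset.sum_eq_zero fun i _ => ?_
    by_cases hi : b i * b i = 0
    · rw [hi, smul_zero]
    · rw [h i hi, zero_mul, zero_smul]

/-- The annihilator is spanned by the natural basis vectors of square zero. -/
theorem finrank_annihilator (hb : ∀ i j, i ≠ j → b i * b j = 0) :
    Module.finrank K (annihilator K N) = Nat.card {i // b i * b i = 0} := by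
  classical
  have hs : annihilator K N = Submodule.span K (Set.range fun i : {i // b i * b i = 0} => b i) := by
    apply le_antisymm
    · intro x hx
      rw [mem_annihilator_iff hb] at hx
      rw [← b.sum_repr x]
      refine Submodule.sum_mem _ fun i _ => ?_
      by_cases hi : b i * b i = 0
      · exact Submodule.smul_mem _ _ (Submodule.subset_span ⟨⟨i, hi⟩, rfl⟩)
      · rw [hx i hi, zero_smul]
        exact Submodule.zero_mem _
    · rw [Submodule.span_le]
      rintro _ ⟨⟨i, hi⟩, rfl⟩ y
      rw [mul_comm, mul_basis hb, hi, smul_zero]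
  rw [hs]
  exact (finrank_span_eq_card (b.linearIndependent.comp _ Subtype.val_injective)).trans
    Nat.card_eq_fintype_card.symm

end NaturalBasis

/-- For z in the annihilator but outside H, take a linear form f with f(H) = 0 and f(z) ≠ 0. Its
kernel contains all products, hence is an ideal, and it is complementary to the ideal Kz. A nonzero
product ensures that the kernel is nonzero. -/
theorem annihilator_le_of_mul_mem {K : Type*} [Field K] {N : Type*}
    [NonUnitalNonAssocCommRing N] [Module K N] [IsScalarTower K N N]
    (hind : ¬ IsDecomposable K N) {H : Submodule K N}
    (hH : ∀ x y : N, x * y ∈ H) (hne : ∃ x y : N, x * y ≠ 0) : annihilator K N ≤ H := by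
  intro z hz
  by_contra hzH
  obtain ⟨f, hfz, hf⟩ := Submodule.exists_dual_map_eq_bot_of_notMem hzH inferInstance
  have hfH : ∀ x ∈ H, f x = 0 := fun x hx => by
    have : f x ∈ H.map f := Submodule.mem_map_of_mem hx
    rwa [hf, Submodule.mem_bot] at this
  refine hind ⟨LinearMap.ker f, K ∙ z, ?_, ?_, ?_, ?_, ?_, ?_⟩
  · exact fun x _ y => hfH _ (hH x y)
  · intro x hx y
    obtain ⟨c, rfl⟩ := Submodule.mem_span_singleton.1 hx
    rw [smul_mul_assoc, hz y, smul_zero]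
    exact Submodule.zero_mem _
  · obtain ⟨x, y, hxy⟩ := hne
    intro h
    have : x * y ∈ LinearMap.ker f := hfH _ (hH x y)
    rw [h] at this
    exact hxy this
  · rw [Ne, Submodule.span_singleton_eq_bot]
    rintro rfl
    exact hfz (map_zero f)
  · rw [Submodule.disjoint_def]
    intro x hx hx'
    obtain ⟨c, rfl⟩ := Submodule.mem_span_singleton.1 hx'
    rw [LinearMap.mem_ker, map_smul, smul_eq_mul, mul_eq_zero] at hx
    rw [hx.resolve_right hfz, zero_smul]
  · rw [codisjoint_iff, eq_top_iff]
    intro x _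
    refine Submodule.mem_sup.2 ⟨x - (f x / f z) • z, ?_, (f x / f z) • z,
      Submodule.smul_mem _ _ (Submodule.mem_span_singleton_self z), sub_add_cancel _ _⟩
    rw [LinearMap.mem_ker, map_sub, map_smul, smul_eq_mul, div_mul_cancel₀ _ hfz, sub_self]

/-! ### Vanishing identities from power-associativity. -/

section PowerAssociative

variable {K : Type*} [Field K] {N : Type*} [NonUnitalNonAssocCommRing N] [Module K N]
  [IsScalarTower K N N] {ι : Type*} [Fintype ι]
  {b : Module.Basis ι K N}

theorem sq_mul_sq (hpa : IsPowerAssociative N) (x : N) : x * x * (x * x) = x * x * x * x :=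
  hpa x 1 1

/-- For x = b_i + b_j the fourth power is zero by `fourth_pow_add` and `repr_sq_mul_repr_sq`, while
x²x² reduces to 2 b_i²b_j². -/
theorem sq_mul_sq_basis (h2 : (2 : K) ≠ 0) (hb : ∀ i j, i ≠ j → b i * b j = 0)
    (hnil : IsNilAlgebra N) (hpa : IsPowerAssociative N) (i j : ι) :
    b i * b i * (b j * b j) = 0 := by
  have hself : ∀ i, b i * b i * (b i * b i) = 0 := fun i => by
    rw [sq_mul_sq hpa, mul_basis hb (b i * b i) i, repr_sq_self hb hnil, zero_smul, zero_mul]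
  by_cases hij : i = j
  · rw [hij, hself]
  have h := sq_mul_sq hpa (b i + b j)
  have h1 := fourth_pow_add hb hnil hij
  rw [h1, repr_sq_mul_repr_sq hb hnil, zero_smul, sq_add_basis hb hij, add_mul,
    mul_add, mul_add, hself, hself, zero_add, add_zero, mul_comm (b j * b j)] at h
  exact eq_zero_of_add_self h2 h

theorem eq_top_of_annihilator_le (hb : ∀ i j, i ≠ j → b i * b j = 0) {H : Submodule K N}
    (hH : annihilator K N ≤ H) (hH' : ∀ i, b i * b i ≠ 0 → b i ∈ H) : H = ⊤ := by
  rw [eq_top_iff, ← b.span_eq, Submodule.span_le]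
  rintro _ ⟨i, rfl⟩
  by_cases hi : b i * b i = 0
  · refine hH fun y => ?_
    rw [mul_comm, mul_basis hb, hi, smul_zero]
  · exact hH' i hi

variable [SMulCommClass K N N]

/-- The square of a power-associative evolution nilalgebra has zero multiplication. -/
theorem mul_mul_mul_eq_zero (h2 : (2 : K) ≠ 0) (hb : ∀ i j, i ≠ j → b i * b j = 0)
    (hnil : IsNilAlgebra N) (hpa : IsPowerAssociative N) (x y z w : N) :
    x * y * (z * w) = 0 := by
  rw [mul_eq_sum hb x y, mul_eq_sum hb z w, Finset.sum_mul]
  refine Finset.sum_eq_zero fun i _ => ?_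
  rw [Finset.mul_sum]
  refine Finset.sum_eq_zero fun j _ => ?_
  rw [smul_mul_assoc, mul_smul_comm, sq_mul_sq_basis h2 hb hnil hpa, smul_zero, smul_zero]

theorem fourth_pow_eq_zero (h2 : (2 : K) ≠ 0) (hb : ∀ i j, i ≠ j → b i * b j = 0)
    (hnil : IsNilAlgebra N) (hpa : IsPowerAssociative N) (x : N) : x * x * x * x = 0 := by
  rw [← sq_mul_sq hpa, mul_mul_mul_eq_zero h2 hb hnil hpa]

/-- Adding the fourth powers of y + b_p and y - b_p keeps only the terms of even degree in b_p. Of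
these, y⁴ and ((y²)b_p)b_p vanish, leaving 2((b_p²)y)y = 0. -/
theorem sq_mul_mul_basis (h2 : (2 : K) ≠ 0) (hb : ∀ i j, i ≠ j → b i * b j = 0)
    (hnil : IsNilAlgebra N) (hpa : IsPowerAssociative N) (p : ι) (y : N) (hy : b p * y = 0) :
    b p * b p * y * y = 0 := by
  have hp : y * y * b p * b p = 0 := by
    rw [mul_basis hb (y * y), smul_mul_assoc, mul_basis hb (b p * b p), repr_sq_self hb hnil,
      zero_smul, smul_zero]
  have hpp : b p * b p * b p = 0 := by
    rw [mul_basis hb (b p * b p), repr_sq_self hb hnil, zero_smul]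
  have h1 := fourth_pow_eq_zero h2 hb hnil hpa (y + b p)
  have h3 := fourth_pow_eq_zero h2 hb hnil hpa (y - b p)
  have h4 := fourth_pow_eq_zero h2 hb hnil hpa y
  have hy' : y * b p = 0 := by rw [mul_comm, hy]
  simp only [add_mul, sub_mul, mul_add, mul_sub, hy, hy', h4, hp, hpp, sub_zero,
    zero_sub, sub_neg_eq_add, add_zero, zero_add] at h1 h3
  refine eq_zero_of_add_self h2 ?_
  have h5 := congrArg₂ (· + ·) h1 h3
  simp only [add_zero] at h5
  rw [← h5]
  abel

/-- The structure constants of two consecutive steps vanish unless the last vector annihilates. -/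
theorem repr_sq_mul_repr_sq_smul (h2 : (2 : K) ≠ 0) (hb : ∀ i j, i ≠ j → b i * b j = 0)
    (hnil : IsNilAlgebra N) (hpa : IsPowerAssociative N) (p q r : ι) :
    (b.repr (b p * b p) q * b.repr (b q * b q) r) • (b r * b r) = 0 := by
  by_cases hpq : p = q
  · rw [hpq, repr_sq_self hb hnil, zero_mul, zero_smul]
  by_cases hpr : p = r
  · rw [hpr, repr_sq_mul_repr_sq hb hnil, zero_smul]
  have hq : b p * b p * b q * b q = 0 := sq_mul_mul_basis h2 hb hnil hpa p _ (hb p q hpq)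
  have hr : b p * b p * b r * b r = 0 := sq_mul_mul_basis h2 hb hnil hpa p _ (hb p r hpr)
  -- Polarization in y yields a_pq a_qr b_r² + a_pr a_rq b_q² = 0; as a_qr a_rq = 0, at most one
  -- term survives, and it then vanishes.
  have h := sq_mul_mul_basis h2 hb hnil hpa p (b q + b r)
    (by rw [mul_add, hb p q hpq, hb p r hpr, add_zero])
  simp only [mul_add, add_mul, hq, hr, zero_add, add_zero] at h
  rw [mul_basis hb (b p * b p) q, mul_basis hb (b p * b p) r, smul_mul_assoc, smul_mul_assoc,
    mul_basis hb (b q * b q) r, mul_basis hb (b r * b r) q, smul_smul, smul_smul] at h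
  rcases mul_eq_zero.1 (repr_sq_mul_repr_sq hb hnil q r) with h0 | h0
  · rw [h0, mul_zero, zero_smul]
  · rw [h0, mul_zero, zero_smul] at h
    simpa using h

/-- If `b p ^ 2` involves `b q`, then `b q ^ 2` lies in the annihilator. -/
theorem repr_sq_eq_zero (h2 : (2 : K) ≠ 0) (hb : ∀ i j, i ≠ j → b i * b j = 0)
    (hnil : IsNilAlgebra N) (hpa : IsPowerAssociative N) {p q r : ι}
    (hpq : b.repr (b p * b p) q ≠ 0) (hr : b r * b r ≠ 0) : b.repr (b q * b q) r = 0 := by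
  have h := repr_sq_mul_repr_sq_smul h2 hb hnil hpa p q r
  exact (mul_eq_zero.1 ((smul_eq_zero.1 h).resolve_right hr)).resolve_left hpq

/-- Without such a pair every product of three elements would be zero, and the algebra would be
associative. -/
theorem exists_structure_constant (hb : ∀ i j, i ≠ j → b i * b j = 0)
    (hassoc : ¬ IsAssociativeAlgebra N) :
    ∃ i k, b.repr (b i * b i) k ≠ 0 ∧ b k * b k ≠ 0 := by
  by_contra! hcon
  have h3 : ∀ x y z : N, x * y * z = 0 := by
    intro x y z
    rw [mul_eq_sum hb x y, Finset.sum_mul]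
    refine Finset.sum_eq_zero fun i _ => ?_
    rw [smul_mul_assoc, mul_eq_sum hb, Finset.sum_eq_zero, smul_zero]
    intro k _
    by_cases h : b.repr (b i * b i) k = 0
    · rw [h, zero_mul, zero_smul]
    · rw [hcon i k h, smul_zero]
  refine hassoc fun x y z => ?_
  rw [h3, mul_comm x, h3]

theorem mul_mem_of_sq_mem (hb : ∀ i j, i ≠ j → b i * b j = 0) {H : Submodule K N}
    (hH : ∀ i, b i * b i ∈ H) (x y : N) : x * y ∈ H := by
  rw [mul_eq_sum hb]
  exact Submodule.sum_mem _ fun i _ => Submodule.smul_mem _ _ (hH i)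

theorem annihilator_le_of_sq_mem (hb : ∀ i j, i ≠ j → b i * b j = 0) (hind : ¬ IsDecomposable K N)
    (hne : ∃ i, b i * b i ≠ 0) {H : Submodule K N} (hH : ∀ i, b i * b i ∈ H) :
    annihilator K N ≤ H :=
  annihilator_le_of_mul_mem hind (mul_mem_of_sq_mem hb hH) (hne.elim fun i hi => ⟨b i, b i, hi⟩)

end PowerAssociative

/-! ### Dimension six and an adapted natural basis. -/

section Classification

variable {K : Type*} [Field K] {N : Type*} [NonUnitalNonAssocCommRing N] [Module K N]
  [IsScalarTower K N N] [SMulCommClass K N N]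

/-- A spanning family of the right size is a basis, so linear independence never has to be checked
by hand. -/
theorem algebraIsomorphic_of_span {n : ℕ} (M : Matrix (Fin n) (Fin n) K) (v : Fin n → N)
    (hspan : Submodule.span K (Set.range v) = ⊤) (hn : Module.finrank K N = n)
    (hv : ∀ i j, i ≠ j → v i * v j = 0) (hsq : ∀ i, v i * v i = ∑ k, M i k • v k) :
    AlgebraIsomorphic K N (EvolutionAlgebra M) := by
  let B : Module.Basis (Fin n) K N :=
    basisOfTopLeSpanOfCardEqFinrank v hspan.ge (by rw [hn, Fintype.card_fin])
  have hB : ⇑B = v := coe_basisOfTopLeSpanOfCardEqFinrank v hspan.ge _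
  refine ⟨(B.equivFun : N ≃ₗ[K] (Fin n → K)), fun x y => ?_⟩
  funext k
  rw [EvolutionAlgebra.mul_apply]
  change B.repr (x * y) k = ∑ i, B.repr x i * B.repr y i * M i k
  rw [mul_eq_sum (b := B) (by rwa [hB])]
  simp only [map_sum, map_smul, Finsupp.coe_finsetSum, Finset.sum_apply, Finsupp.smul_apply,
    smul_eq_mul]
  refine Finset.sum_congr rfl fun i _ => ?_
  have : B i * B i = ∑ k, M i k • B k := by rw [hB, hsq]
  rw [this, B.repr_sum_self]

theorem exists_adapted_basis (h2 : (2 : K) ≠ 0) (h : InClass K N) :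
    ∃ c : Module.Basis (Fin 6) K N, (∀ i j, i ≠ j → c i * c j = 0) ∧
      c 0 * c 0 ≠ 0 ∧ c 1 * c 1 ≠ 0 ∧ c 2 * c 2 ≠ 0 ∧ c 3 * c 3 ≠ 0 ∧
      c 4 * c 4 = 0 ∧ c 5 * c 5 = 0 ∧
      c.repr (c 0 * c 0) 1 ≠ 0 ∧ c.repr (c 0 * c 0) 2 ≠ 0 := by
  obtain ⟨⟨n, b, hb⟩, hnil, hpa, hassoc, hind, hdim, hann⟩ := h
  obtain ⟨i, k, hik, hk⟩ := exists_structure_constant hb hassoc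
  have hi : b i * b i ≠ 0 := by
    intro h
    rw [h] at hik
    simp at hik
  have hik' : i ≠ k := by
    rintro rfl
    exact hik (repr_sq_self hb hnil i)
  have hsum := mul_mul_mul_eq_zero h2 hb hnil hpa (b i) (b i) (b i) (b i)
  rw [mul_eq_sum hb (b i * b i)] at hsum
  -- `hsum` says Σ a_ij² b_j² = 0, and its nonzero term at k cannot be the only one.
  obtain ⟨l, hlk, hil, hl⟩ : ∃ l, l ≠ k ∧ b.repr (b i * b i) l ≠ 0 ∧ b l * b l ≠ 0 := by
    by_contra! hcon
    rw [Finset.sum_eq_single k] at hsum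
    · exact (smul_ne_zero (mul_ne_zero hik hik) hk) hsum
    · intro l _ hl
      by_cases h0 : b.repr (b i * b i) l = 0
      · rw [h0, zero_mul, zero_smul]
      · rw [hcon l hl h0, smul_zero]
    · simp
  have hil' : i ≠ l := by
    rintro rfl
    exact hil (repr_sq_self hb hnil i)
  rw [finrank_annihilator hb, Nat.card_eq_two_iff] at hann
  obtain ⟨⟨z, hz⟩, ⟨z', hz'⟩, hzz, -⟩ := hann
  have hzz' : z ≠ z' := fun h => hzz (Subtype.ext h)
  have hne : ∀ {p q}, b p * b p ≠ 0 → b q * b q = 0 → p ≠ q := by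
    rintro p _ hp hq rfl
    exact hp hq
  have hfin : Module.finrank K N = n := by rw [Module.finrank_eq_card_basis b, Fintype.card_fin]
  obtain ⟨m, hm, him, hkm, hlm⟩ : ∃ m, b m * b m ≠ 0 ∧ i ≠ m ∧ k ≠ m ∧ l ≠ m := by
    by_contra! hcon
    have h5 : 5 ≤ n := by
      have hinj : Function.Injective ![i, k, l, z, z'] := by
        have h1 := hne hi hz
        have h2 := hne hi hz'
        have h3 := hne hk hz
        have h4 := hne hk hz'
        have h5 := hne hl hz
        have h6 := hne hl hz'
        clear hne hcon
        intro x y hxy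
        fin_cases x <;> fin_cases y <;> simp_all [eq_comm]
      simpa using Fintype.card_le_of_injective _ hinj
    -- If i, k, l were the only non-annihilating indices, this H would be all of N, against 5 ≤ n.
    -- It contains b_l² by `hsum`, hence N², hence the annihilator.
    let H : Submodule K N := Submodule.span K (Set.range ![b i, b k, b i * b i, b k * b k])
    have hmem : ∀ x : Fin 4, ![b i, b k, b i * b i, b k * b k] x ∈ H :=
      fun x => Submodule.subset_span ⟨x, rfl⟩
    have hcon' : ∀ m, m ≠ i → m ≠ k → m ≠ l → b m * b m = 0 := by
      intro m h1 h2 h3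
      by_contra h4
      exact h3 (hcon m h4 (Ne.symm h1) (Ne.symm h2)).symm
    have hll : b l * b l ∈ H := by
      rw [← Finset.sum_subset (Finset.subset_univ {k, l}), Finset.sum_pair hlk.symm] at hsum
      · rw [← H.smul_mem_iff (mul_ne_zero hil hil), eq_neg_of_add_eq_zero_right hsum]
        exact H.neg_mem (H.smul_mem _ (hmem 3))
      · intro x _ hx
        simp only [Finset.mem_insert, Finset.mem_singleton, not_or] at hx
        by_cases hxi : x = i
        · rw [hxi, repr_sq_self hb hnil, zero_mul, zero_smul]
        · rw [hcon' x hxi hx.1 hx.2, smul_zero]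
    have hsq : ∀ x, b x * b x ∈ H := by
      intro x
      by_cases h1 : x = i
      · rw [h1]; exact hmem 2
      by_cases h2 : x = k
      · rw [h2]; exact hmem 3
      by_cases h3 : x = l
      · rw [h3]; exact hll
      rw [hcon' x h1 h2 h3]
      exact H.zero_mem
    have hannH := annihilator_le_of_sq_mem hb hind ⟨i, hi⟩ hsq
    have htop : H = ⊤ := by
      refine eq_top_of_annihilator_le hb hannH fun x hx => ?_
      by_cases h1 : x = i
      · rw [h1]; exact hmem 0
      by_cases h2 : x = k
      · rw [h2]; exact hmem 1
      by_cases h3 : x = l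
      · rw [h3, ← H.smul_mem_iff hil]
        -- Modulo the annihilator, b_i² is a combination of b_k and b_l, so b_l can be recovered
        -- from vectors of H.
        have hw : b i * b i - b.repr (b i * b i) k • b k - b.repr (b i * b i) l • b l ∈ H := by
          refine hannH ((mem_annihilator_iff hb _).2 fun y hy => ?_)
          simp only [map_sub, map_smul, Finsupp.sub_apply, Finsupp.smul_apply,
            Module.Basis.repr_self, smul_eq_mul]
          by_cases h4 : y = i
          · rw [h4, repr_sq_self hb hnil, Finsupp.single_eq_of_ne hik',
              Finsupp.single_eq_of_ne hil', mul_zero, mul_zero, sub_zero, sub_zero]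
          by_cases h5 : y = k
          · rw [h5, Finsupp.single_eq_same, Finsupp.single_eq_of_ne hlk.symm, mul_one, sub_self,
              mul_zero, sub_zero]
          by_cases h6 : y = l
          · rw [h6, Finsupp.single_eq_same, Finsupp.single_eq_of_ne hlk, mul_one, mul_zero,
              sub_zero, sub_self]
          exact absurd (hcon' y h4 h5 h6) hy
        have h7 := H.sub_mem (H.sub_mem (hmem 2) (H.smul_mem (b.repr (b i * b i) k) (hmem 1))) hw
        convert h7 using 1
        simp
      exact absurd (hcon' x h1 h2 h3) hx
    have h4 : Module.finrank K H ≤ 4 := by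
      simpa [Set.finrank] using finrank_range_le_card (R := K) ![b i, b k, b i * b i, b k * b k]
    rw [htop, finrank_top, hfin] at h4
    omega
  have hinj : Function.Injective ![i, k, l, m, z, z'] := by
    have h1 := hne hi hz
    have h2 := hne hi hz'
    have h3 := hne hk hz
    have h4 := hne hk hz'
    have h5 := hne hl hz
    have h6 := hne hl hz'
    have h7 := hne hm hz
    have h8 := hne hm hz'
    clear hne
    intro x y hxy
    fin_cases x <;> fin_cases y <;> simp_all [eq_comm]
  obtain rfl : n = 6 := by
    have := Fintype.card_le_of_injective _ hinj
    simp only [Fintype.card_fin] at this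
    omega
  let σ : Fin 6 ≃ Fin 6 := Equiv.ofBijective _ (Finite.injective_iff_bijective.1 hinj)
  have hσ : ∀ x, b.reindex σ.symm x = b (![i, k, l, m, z, z'] x) := fun x => by
    rw [Module.Basis.reindex_apply, Equiv.symm_symm]
    rfl
  refine ⟨b.reindex σ.symm, ?_, ?_, ?_, ?_, ?_, ?_, ?_, ?_, ?_⟩
  · intro x y hxy
    rw [hσ, hσ]
    exact hb _ _ (hinj.ne hxy)
  · rwa [hσ]
  · rwa [hσ]
  · rwa [hσ]
  · rwa [hσ]
  · rwa [hσ]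
  · rwa [hσ]
  · rw [hσ, Module.Basis.repr_reindex_apply, Equiv.symm_symm]
    exact hik
  · rw [hσ, Module.Basis.repr_reindex_apply, Equiv.symm_symm]
    exact hil

end Classification

/-! ### Reduction to the two normal forms. -/

section Classification

variable {K : Type*} [Field K] {N : Type*} [NonUnitalNonAssocCommRing N] [Module K N]

theorem IsDecomposable.of_algebraIsomorphic {N' : Type*} [NonUnitalNonAssocCommRing N']
    [Module K N'] (h : AlgebraIsomorphic K N N') (hN' : IsDecomposable K N') :
    IsDecomposable K N := by
  obtain ⟨f, hf⟩ := h
  obtain ⟨I, J, hI, hJ, hI0, hJ0, hIJ⟩ := hN'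
  have hid : ∀ {I : Submodule K N'}, IsAlgebraIdeal I → IsAlgebraIdeal (I.comap f.toLinearMap) := by
    intro I hI x hx y
    rw [Submodule.mem_comap] at hx ⊢
    change f (x * y) ∈ I
    rw [hf]
    exact hI _ hx _
  have hbot : ∀ {I : Submodule K N'}, I ≠ ⊥ → I.comap f.toLinearMap ≠ ⊥ := by
    intro I hI h
    refine hI ((Submodule.eq_bot_iff _).2 fun x hx => ?_)
    have hx' : f.symm x ∈ I.comap f.toLinearMap := by simpa using hx
    rw [h, Submodule.mem_bot] at hx'
    simpa using hx'
  refine ⟨_, _, hid hI, hid hJ, hbot hI0, hbot hJ0, ?_⟩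
  have := (Submodule.orderIsoMapComap f.symm).isCompl hIJ
  simpa [Submodule.map_equiv_eq_comap_symm] using this

/-- For α = 0 the spans of e₁, e₂, e₃, e₅ and of e₄, e₆ are complementary ideals. This rules out α =
0 in the classification. -/
theorem isDecomposable_N625_zero : IsDecomposable K (N625 (0 : K)) := by
  refine ⟨{ carrier := {x | x 3 = 0 ∧ x 5 = 0}, add_mem' := ?_, zero_mem' := ?_, smul_mem' := ?_ },
    { carrier := {x | x 0 = 0 ∧ x 1 = 0 ∧ x 2 = 0 ∧ x 4 = 0}, add_mem' := ?_, zero_mem' := ?_,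
      smul_mem' := ?_ }, ?_, ?_, ?_, ?_, ?_, ?_⟩
  · rintro x y ⟨h1, h2⟩ ⟨h3, h4⟩
    simp [EvolutionAlgebra.add_apply, h1, h2, h3, h4]
  · simp [EvolutionAlgebra.zero_apply]
  · rintro c x ⟨h1, h2⟩
    simp [EvolutionAlgebra.smul_apply, h1, h2]
  · rintro x y ⟨h1, h2, h5, h6⟩ ⟨h3, h4, h7, h8⟩
    simp [EvolutionAlgebra.add_apply, h1, h2, h3, h4, h5, h6, h7, h8]
  · simp [EvolutionAlgebra.zero_apply]
  · rintro c x ⟨h1, h2, h3, h4⟩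
    simp [EvolutionAlgebra.smul_apply, h1, h2, h3, h4]
  · rintro x ⟨h1, h2⟩ y
    constructor <;> simp [EvolutionAlgebra.mul_apply, structureMatrix625, Fin.sum_univ_six, h1]
  · rintro x ⟨h1, h2, h3, h4⟩ y
    refine ⟨?_, ?_, ?_, ?_⟩ <;>
      simp [EvolutionAlgebra.mul_apply, structureMatrix625, Fin.sum_univ_six, h1, h2, h3]
  · rw [Submodule.ne_bot_iff]
    refine ⟨EvolutionAlgebra.e _ 0, ?_, fun h => ?_⟩
    · simp [EvolutionAlgebra.e_apply]
    · simpa [EvolutionAlgebra.e_apply, EvolutionAlgebra.zero_apply] using congrFun h 0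
  · rw [Submodule.ne_bot_iff]
    refine ⟨EvolutionAlgebra.e _ 3, ?_, fun h => ?_⟩
    · simp [EvolutionAlgebra.e_apply]
    · simpa [EvolutionAlgebra.e_apply, EvolutionAlgebra.zero_apply] using congrFun h 3
  · rw [Submodule.disjoint_def]
    rintro x ⟨h1, h2⟩ ⟨h3, h4, h5, h6⟩
    funext k
    fin_cases k <;> assumption
  · rw [codisjoint_iff, eq_top_iff]
    intro x _
    refine Submodule.mem_sup.2 ⟨(![x 0, x 1, x 2, 0, x 4, 0] : Fin 6 → K), ?_,
      (![0, 0, 0, x 3, 0, x 5] : Fin 6 → K), ?_, ?_⟩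
    · exact ⟨rfl, rfl⟩
    · exact ⟨rfl, rfl, rfl, rfl⟩
    · funext k
      fin_cases k <;> first | exact add_zero _ | exact zero_add _

variable [IsScalarTower K N N] [SMulCommClass K N N] {c : Module.Basis (Fin 6) K N}

theorem mem_annihilator_of_repr (hc : ∀ i j, i ≠ j → c i * c j = 0) (hc4 : c 4 * c 4 = 0)
    (hc5 : c 5 * c 5 = 0) {x : N} (h0 : c.repr x 0 = 0) (h1 : c.repr x 1 = 0)
    (h2 : c.repr x 2 = 0) (h3 : c.repr x 3 = 0) : x ∈ annihilator K N := by
  rw [mem_annihilator_iff hc]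
  intro r hr
  fin_cases r
  · exact h0
  · exact h1
  · exact h2
  · exact h3
  · exact absurd hc4 hr
  · exact absurd hc5 hr

/-- Changes of natural basis used below: rescale and shift by annihilating vectors. A scalar s i = 0
replaces a vector by an annihilating one. -/
theorem smul_add_mul_smul_add (s : Fin 6 → K) {z : Fin 6 → N} (hz : ∀ i, z i ∈ annihilator K N)
    (i j : Fin 6) : (s i • c i + z i) * (s j • c j + z j) = (s i * s j) • (c i * c j) := by
  have hr : ∀ y, y * z j = 0 := fun y => by rw [mul_comm]; exact hz j y
  have hl : ∀ y, z i * y = 0 := hz i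
  simp only [mul_add, add_mul, hr, hl, add_zero, smul_mul_assoc, mul_smul_comm, smul_smul]
  rw [mul_comm]

theorem algebraIsomorphic_N626 (h2 : (2 : K) ≠ 0) (h : InClass K N)
    (hc : ∀ i j, i ≠ j → c i * c j = 0) (hc0 : c 0 * c 0 ≠ 0) (hc4 : c 4 * c 4 = 0)
    (hc5 : c 5 * c 5 = 0) (h01 : c.repr (c 0 * c 0) 1 ≠ 0) (h02 : c.repr (c 0 * c 0) 2 ≠ 0)
    (h03 : c.repr (c 0 * c 0) 3 ≠ 0) : AlgebraIsomorphic K N (N626 K) := by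
  obtain ⟨-, hnil, hpa, -, hind, -, -⟩ := h
  have h00 := repr_sq_self hc hnil 0
  have hsq : ∀ {k}, c.repr (c 0 * c 0) k ≠ 0 → c k * c k ∈ annihilator K N := fun hk =>
    (mem_annihilator_iff hc _).2 fun r hr => repr_sq_eq_zero h2 hc hnil hpa hk hr
  have hs1 := hsq h01
  have hs2 := hsq h02
  have hrel := mul_mul_mul_eq_zero h2 hc hnil hpa (c 0) (c 0) (c 0) (c 0)
  rw [mul_eq_sum hc (c 0 * c 0)] at hrel
  simp only [Fin.sum_univ_six, h00, hc4, hc5, smul_zero, zero_mul, zero_smul, zero_add,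
    add_zero] at hrel
  obtain ⟨w, hwann, hw⟩ : ∃ w ∈ annihilator K N, c 0 * c 0 = c.repr (c 0 * c 0) 1 • c 1 + w +
      c.repr (c 0 * c 0) 2 • c 2 + c.repr (c 0 * c 0) 3 • c 3 := by
    refine ⟨c 0 * c 0 - c.repr (c 0 * c 0) 1 • c 1 - c.repr (c 0 * c 0) 2 • c 2 -
      c.repr (c 0 * c 0) 3 • c 3, mem_annihilator_of_repr hc hc4 hc5 ?_ ?_ ?_ ?_, by abel⟩ <;>
    simp [h00]
  have hrel' := eq_neg_of_add_eq_zero_right hrel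
  clear hrel hsq h00
  generalize c.repr (c 0 * c 0) 1 = a1 at *
  generalize c.repr (c 0 * c 0) 2 = a2 at *
  generalize c.repr (c 0 * c 0) 3 = a3 at *
  -- Scaling turns the coefficients of c₀² into 1, and the second vector absorbs its annihilator
  -- part w. The last two vectors are the squares of the second and third; `hrel'` then expresses
  -- the square of the fourth.
  let s : Fin 6 → K := ![1, a1, a2, a3, 0, 0]
  let z : Fin 6 → N := ![0, w, 0, 0, (a1 * a1) • (c 1 * c 1), (a2 * a2) • (c 2 * c 2)]
  have hz : ∀ i, z i ∈ annihilator K N := by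
    intro i
    fin_cases i
    · exact Submodule.zero_mem _
    · exact hwann
    · exact Submodule.zero_mem _
    · exact Submodule.zero_mem _
    · exact Submodule.smul_mem _ _ hs1
    · exact Submodule.smul_mem _ _ hs2
  let v : Fin 6 → N := fun i => s i • c i + z i
  have hv0 : v 0 = c 0 := by simp [v, s, z]
  have hv1 : v 1 = a1 • c 1 + w := by simp [v, s, z]
  have hv2 : v 2 = a2 • c 2 := by simp [v, s, z]
  have hv3 : v 3 = a3 • c 3 := by simp [v, s, z]
  have hv4 : v 4 = (a1 * a1) • (c 1 * c 1) := by simp [v, s, z]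
  have hv5 : v 5 = (a2 * a2) • (c 2 * c 2) := by simp [v, s, z]
  have hmul : ∀ i j, v i * v j = (s i * s j) • (c i * c j) := smul_add_mul_smul_add s hz
  rw [← hv4, ← hv5] at hrel'
  rw [← hv1, ← hv2, ← hv3] at hw
  have hv : ∀ i, v i ∈ Submodule.span K (Set.range v) := fun i => Submodule.subset_span ⟨i, rfl⟩
  have hsqm : ∀ i, c i * c i ∈ Submodule.span K (Set.range v) := by
    intro i
    fin_cases i
    · exact hw ▸ Submodule.add_mem _ (Submodule.add_mem _ (hv 1) (hv 2)) (hv 3)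
    · exact (Submodule.smul_mem_iff _ (mul_ne_zero h01 h01)).1 (hv4 ▸ hv 4)
    · exact (Submodule.smul_mem_iff _ (mul_ne_zero h02 h02)).1 (hv5 ▸ hv 5)
    · refine (Submodule.smul_mem_iff _ (mul_ne_zero h03 h03)).1 ?_
      exact hrel' ▸ Submodule.neg_mem _ (Submodule.add_mem _ (hv 4) (hv 5))
    · exact hc4 ▸ Submodule.zero_mem _
    · exact hc5 ▸ Submodule.zero_mem _
  have hann := annihilator_le_of_sq_mem hc hind ⟨0, hc0⟩ hsqm
  refine algebraIsomorphic_of_span _ v ?_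
    (by rw [Module.finrank_eq_card_basis c, Fintype.card_fin]) ?_ ?_
  · refine eq_top_of_annihilator_le hc hann fun i hi => ?_
    fin_cases i
    · exact hv0 ▸ hv 0
    · refine (Submodule.smul_mem_iff _ h01).1 ?_
      rw [← add_sub_cancel_right (_ • _) w]
      exact Submodule.sub_mem _ (hv1 ▸ hv 1) (hann hwann)
    · exact (Submodule.smul_mem_iff _ h02).1 (hv2 ▸ hv 2)
    · exact (Submodule.smul_mem_iff _ h03).1 (hv3 ▸ hv 3)
    · exact absurd hc4 hi
    · exact absurd hc5 hi
  · intro i j hij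
    rw [hmul, hc i j hij, smul_zero]
  · intro i
    rw [hmul]
    fin_cases i
    · simpa [s, structureMatrix626, Fin.sum_univ_six] using hw
    · simpa [s, structureMatrix626, Fin.sum_univ_six] using hv4.symm
    · simpa [s, structureMatrix626, Fin.sum_univ_six] using hv5.symm
    · simpa [s, structureMatrix626, Fin.sum_univ_six] using hrel'.trans (neg_add _ _)
    · simp [s, structureMatrix626, Fin.sum_univ_six]
    · simp [s, structureMatrix626, Fin.sum_univ_six]

theorem exists_algebraIsomorphic_N625 (h2 : (2 : K) ≠ 0) (h : InClass K N)
    (hc : ∀ i j, i ≠ j → c i * c j = 0) (hc0 : c 0 * c 0 ≠ 0) (hc1 : c 1 * c 1 ≠ 0)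
    (hc4 : c 4 * c 4 = 0)
    (hc5 : c 5 * c 5 = 0) (h01 : c.repr (c 0 * c 0) 1 ≠ 0) (h02 : c.repr (c 0 * c 0) 2 ≠ 0)
    (h03 : c.repr (c 0 * c 0) 3 = 0) : ∃ α : K, AlgebraIsomorphic K N (N625 α) := by
  obtain ⟨-, hnil, hpa, -, hind, -, -⟩ := h
  have h00 := repr_sq_self hc hnil 0
  have h33 := repr_sq_self hc hnil 3
  -- Otherwise c₀² would lie in the annihilator, yet it involves c₁ and c₁² ≠ 0.
  have h30 : c.repr (c 3 * c 3) 0 = 0 := by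
    by_contra h
    exact h01 (repr_sq_eq_zero h2 hc hnil hpa h hc1)
  have hs1 : c 1 * c 1 ∈ annihilator K N :=
    (mem_annihilator_iff hc _).2 fun r hr => repr_sq_eq_zero h2 hc hnil hpa h01 hr
  have hrel := mul_mul_mul_eq_zero h2 hc hnil hpa (c 0) (c 0) (c 0) (c 0)
  rw [mul_eq_sum hc (c 0 * c 0)] at hrel
  have hrel3 := mul_mul_mul_eq_zero h2 hc hnil hpa (c 0) (c 0) (c 3) (c 3)
  rw [mul_eq_sum hc (c 0 * c 0)] at hrel3
  simp only [Fin.sum_univ_six, h00, h03, hc4, hc5, smul_zero, zero_mul, zero_smul, zero_add,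
    add_zero] at hrel hrel3
  -- Eliminating c₂² between c₀²c₀² = 0 and c₀²c₃² = 0 leaves a multiple of c₁² ≠ 0; hence the (c₁,
  -- c₂) parts of c₃² and c₀² are proportional.
  have hprop : c.repr (c 3 * c 3) 1 * c.repr (c 0 * c 0) 2 =
      c.repr (c 3 * c 3) 2 * c.repr (c 0 * c 0) 1 := by
    have h4 := congrArg₂ (c.repr (c 0 * c 0) 2 • · - c.repr (c 3 * c 3) 2 • ·) hrel3 hrel
    simp only [smul_add, smul_smul, smul_zero, sub_zero] at h4
    have h5 : (c.repr (c 0 * c 0) 1 * (c.repr (c 3 * c 3) 1 * c.repr (c 0 * c 0) 2 -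
        c.repr (c 3 * c 3) 2 * c.repr (c 0 * c 0) 1)) • (c 1 * c 1) = 0 := by
      rw [← h4]
      module
    rw [smul_eq_zero_iff_left hc1, mul_eq_zero_iff_left h01] at h5
    exact sub_eq_zero.1 h5
  obtain ⟨α, hα1, hα2⟩ : ∃ α, c.repr (c 3 * c 3) 1 = α * c.repr (c 0 * c 0) 1 ∧
      c.repr (c 3 * c 3) 2 = α * c.repr (c 0 * c 0) 2 := by
    refine ⟨c.repr (c 3 * c 3) 1 / c.repr (c 0 * c 0) 1, ?_, ?_⟩
    · field_simp
    · field_simp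
      rw [hprop]
  obtain ⟨u, huann, hu⟩ : ∃ u ∈ annihilator K N, c 3 * c 3 = α • (c 0 * c 0) + u := by
    refine ⟨c 3 * c 3 - α • (c 0 * c 0), mem_annihilator_of_repr hc hc4 hc5 ?_ ?_ ?_ ?_,
      by abel⟩ <;>
    simp [h00, h03, h30, h33, hα1, hα2]
  obtain ⟨w, hwann, hw⟩ : ∃ w ∈ annihilator K N, c 0 * c 0 = c.repr (c 0 * c 0) 1 • c 1 + w +
      c.repr (c 0 * c 0) 2 • c 2 := by
    refine ⟨c 0 * c 0 - c.repr (c 0 * c 0) 1 • c 1 - c.repr (c 0 * c 0) 2 • c 2,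
      mem_annihilator_of_repr hc hc4 hc5 ?_ ?_ ?_ ?_, by abel⟩ <;>
    simp [h00, h03]
  have hrel' := eq_neg_of_add_eq_zero_right hrel
  clear hrel hrel3 hprop hα1 hα2 h00 h03
  generalize c.repr (c 0 * c 0) 1 = a1 at *
  generalize c.repr (c 0 * c 0) 2 = a2 at *
  -- Here the fifth vector is the square of the second, and the sixth is the annihilator part u of
  -- c₃².
  let s : Fin 6 → K := ![1, a1, a2, 1, 0, 0]
  let z : Fin 6 → N := ![0, w, 0, 0, (a1 * a1) • (c 1 * c 1), u]
  have hz : ∀ i, z i ∈ annihilator K N := by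
    intro i
    fin_cases i
    · exact Submodule.zero_mem _
    · exact hwann
    · exact Submodule.zero_mem _
    · exact Submodule.zero_mem _
    · exact Submodule.smul_mem _ _ hs1
    · exact huann
  let v : Fin 6 → N := fun i => s i • c i + z i
  have hv0 : v 0 = c 0 := by simp [v, s, z]
  have hv1 : v 1 = a1 • c 1 + w := by simp [v, s, z]
  have hv2 : v 2 = a2 • c 2 := by simp [v, s, z]
  have hv3 : v 3 = c 3 := by simp [v, s, z]
  have hv4 : v 4 = (a1 * a1) • (c 1 * c 1) := by simp [v, s, z]
  have hv5 : v 5 = u := by simp [v, s, z]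
  have hmul : ∀ i j, v i * v j = (s i * s j) • (c i * c j) := smul_add_mul_smul_add s hz
  rw [← hv4] at hrel'
  rw [← hv1, ← hv2] at hw
  rw [hw, ← hv5] at hu
  have hv : ∀ i, v i ∈ Submodule.span K (Set.range v) := fun i => Submodule.subset_span ⟨i, rfl⟩
  have hsqm : ∀ i, c i * c i ∈ Submodule.span K (Set.range v) := by
    intro i
    fin_cases i
    · exact hw ▸ Submodule.add_mem _ (hv 1) (hv 2)
    · exact (Submodule.smul_mem_iff _ (mul_ne_zero h01 h01)).1 (hv4 ▸ hv 4)
    · refine (Submodule.smul_mem_iff _ (mul_ne_zero h02 h02)).1 ?_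
      exact hrel' ▸ Submodule.neg_mem _ (hv 4)
    · exact hu ▸ Submodule.add_mem _
        (Submodule.smul_mem _ _ (Submodule.add_mem _ (hv 1) (hv 2))) (hv 5)
    · exact hc4 ▸ Submodule.zero_mem _
    · exact hc5 ▸ Submodule.zero_mem _
  have hann := annihilator_le_of_sq_mem hc hind ⟨0, hc0⟩ hsqm
  refine ⟨α, algebraIsomorphic_of_span _ v ?_
    (by rw [Module.finrank_eq_card_basis c, Fintype.card_fin]) ?_ ?_⟩
  · refine eq_top_of_annihilator_le hc hann fun i hi => ?_
    -- The span contains all squares, so by indecomposability the annihilator; hence w can be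
    -- subtracted to recover c₁.
    fin_cases i
    · exact hv0 ▸ hv 0
    · refine (Submodule.smul_mem_iff _ h01).1 ?_
      rw [← add_sub_cancel_right (_ • _) w]
      exact Submodule.sub_mem _ (hv1 ▸ hv 1) (hann hwann)
    · exact (Submodule.smul_mem_iff _ h02).1 (hv2 ▸ hv 2)
    · exact hv3 ▸ hv 3
    · exact absurd hc4 hi
    · exact absurd hc5 hi
  · intro i j hij
    rw [hmul, hc i j hij, smul_zero]
  · intro i
    rw [hmul]
    fin_cases i
    · simpa [s, structureMatrix625, Fin.sum_univ_six] using hw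
    · simpa [s, structureMatrix625, Fin.sum_univ_six] using hv4.symm
    · simpa [s, structureMatrix625, Fin.sum_univ_six] using hrel'
    · simpa [s, structureMatrix625, Fin.sum_univ_six] using hu
    · simp [s, structureMatrix625, Fin.sum_univ_six]
    · simp [s, structureMatrix625, Fin.sum_univ_six]

theorem InClass.classification (h2 : (2 : K) ≠ 0) (h : InClass K N) :
    (∃ α : K, α ≠ 0 ∧ AlgebraIsomorphic K N (N625 α)) ∨ AlgebraIsomorphic K N (N626 K) := by
  obtain ⟨c, hc, hc0, hc1, -, -, hc4, hc5, h01, h02⟩ := exists_adapted_basis h2 h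
  by_cases h03 : c.repr (c 0 * c 0) 3 = 0
  · obtain ⟨α, hα⟩ := exists_algebraIsomorphic_N625 h2 h hc hc0 hc1 hc4 hc5 h01 h02 h03
    refine Or.inl ⟨α, ?_, hα⟩
    rintro rfl
    exact h.indecomposable (isDecomposable_N625_zero.of_algebraIsomorphic hα)
  · exact Or.inr (algebraIsomorphic_N626 h2 h hc hc0 hc4 hc5 h01 h02 h03)

end Classification

/-! ### Coordinates in an algebra given by a structure matrix. -/

section General

variable {K : Type*} [Field K]

namespace EvolutionAlgebra

variable {n : ℕ} (M : Matrix (Fin n) (Fin n) K)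

/-- The standard basis of an evolution algebra given by a structure matrix. -/
noncomputable def stdBasis : Module.Basis (Fin n) K (EvolutionAlgebra M) :=
  Module.Basis.ofEquivFun (LinearEquiv.refl K (Fin n → K))

theorem stdBasis_apply (i : Fin n) : stdBasis M i = e M i := by
  funext k
  refine (DFunLike.congr_fun ((stdBasis M).repr_self i) k).trans ?_
  rw [e_apply, Finsupp.single_apply]
  simp only [eq_comm]

theorem stdBasis_mul_of_ne (i j : Fin n) (h : i ≠ j) : stdBasis M i * stdBasis M j = 0 := by
  rw [stdBasis_apply, stdBasis_apply, e_mul_e_of_ne M h]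

theorem coord_stdBasis_ne_zero (i : Fin n) : (stdBasis M).coord i ≠ 0 := fun h => by
  have := LinearMap.congr_fun h (stdBasis M i)
  simp at this

theorem isEvolutionAlgebra : IsEvolutionAlgebra K (EvolutionAlgebra M) :=
  ⟨n, stdBasis M, stdBasis_mul_of_ne M⟩

theorem finrank_eq : Module.finrank K (EvolutionAlgebra M) = n := by
  rw [Module.finrank_eq_card_basis (stdBasis M), Fintype.card_fin]

variable {M}

theorem neg_apply (x : EvolutionAlgebra M) (k : Fin n) : (-x) k = -x k := rfl

theorem sub_apply (x y : EvolutionAlgebra M) (k : Fin n) : (x - y) k = x k - y k := by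
  rw [sub_eq_add_neg, EvolutionAlgebra.add_apply, neg_apply, sub_eq_add_neg]

theorem apply_eq_sum (d : Module.End K (EvolutionAlgebra M)) (x : EvolutionAlgebra M)
    (k : Fin n) : d x k = ∑ i, x i * d (e M i) k := by
  have h : (stdBasis M).repr (d x) k =
      ∑ i, (stdBasis M).repr x i * (stdBasis M).repr (d (stdBasis M i)) k := by
    conv_lhs => rw [← (stdBasis M).sum_repr x]
    simp only [map_sum, map_smul, Finsupp.coe_finsetSum, Finset.sum_apply, Finsupp.smul_apply,
      smul_eq_mul]
  simp only [stdBasis_apply] at h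
  exact h

end EvolutionAlgebra

end General

/-! ### Criteria for nil and power-associative algebras. -/

section Nilpotent

variable {N : Type*} [NonUnitalNonAssocCommRing N]

/-- If all products of degree four vanish, the algebra is a power-associative nilalgebra. -/
theorem isNilAlgebra_of_mul_mul_mul (h : ∀ x y z w : N, x * y * z * w = 0) : IsNilAlgebra N :=
  fun a => ⟨3, h a a a a⟩

theorem isPowerAssociative_of_sq (h : ∀ x y z w : N, x * y * z * w = 0)
    (h' : ∀ x : N, x * x * (x * x) = 0) : IsPowerAssociative N := by
  have hz : ∀ (x : N) k, principalPow x (k + 3) = 0 := fun x k =>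
    principalPow_eq_zero_of_le (k := 3) (h x x x x) (by omega)
  have hz' : ∀ (x y : N) k, y * principalPow x (k + 2) = 0 := by
    intro x y k
    rw [mul_comm]
    cases k with
    | zero => exact h x x x y
    | succ k => rw [hz, zero_mul]
  -- With shifted exponents, (0, j) is the definition of powers, (1, 1) is x²x² = 0 = x⁴, and all
  -- remaining products have a factor of exponent at least 3 and vanish.
  have key : ∀ (x : N) (i j : ℕ), i ≤ j →
      principalPow x i * principalPow x j = principalPow x (i + j + 1) := by
    intro x i j hij
    match i, j with
    | 0, j => rw [zero_add, principalPow_succ, mul_comm]; rfl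
    | 1, 0 => omega
    | 1, 1 => rw [show 1 + 1 + 1 = 0 + 3 from rfl, hz]; exact h' x
    | i + 1, j + 2 => rw [hz', show i + 1 + (j + 2) + 1 = (i + j + 1) + 3 by ring, hz]
    | i + 2, 1 => omega
    | i + 2, 0 => omega
  intro x i j
  rcases le_total i j with hij | hij
  · exact key x i j hij
  · rw [mul_comm, key x j i hij, add_comm j i]

end Nilpotent

/-! ### A criterion for indecomposability. -/

section Indecomposable

variable {K : Type*} [Field K] {N : Type*} [NonUnitalNonAssocCommRing N] [Module K N]

theorem mul_eq_zero_of_disjoint {I J : Submodule K N} (hI : IsAlgebraIdeal I)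
    (hJ : IsAlgebraIdeal J) (hIJ : Disjoint I J) {x y : N} (hx : x ∈ I) (hy : y ∈ J) :
    x * y = 0 :=
  Submodule.disjoint_def.1 hIJ _ (hI x hx y) (by rw [mul_comm]; exact hJ y hy x)

/-- A criterion for indecomposability in terms of a linear form `f`. -/
theorem not_isDecomposable_of_forall (f : N →ₗ[K] K) (hf : f ≠ 0)
    (h : ∀ I J : Submodule K N, IsAlgebraIdeal I → IsAlgebraIdeal J → IsCompl I J →
      (∃ x ∈ I, f x ≠ 0) → J = ⊥) : ¬ IsDecomposable K N := by
  rintro ⟨I, J, hI, hJ, hI0, hJ0, hIJ⟩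
  refine hf (LinearMap.ext fun z => ?_)
  obtain ⟨x, hx, y, hy, rfl⟩ := Submodule.mem_sup.1 (hIJ.sup_eq_top ▸ Submodule.mem_top (x := z))
  have hx0 : f x = 0 := by
    by_contra hne
    exact hJ0 (h I J hI hJ hIJ ⟨x, hx, hne⟩)
  have hy0 : f y = 0 := by
    by_contra hne
    exact hI0 (h J I hJ hI hIJ.symm ⟨y, hy, hne⟩)
  rw [map_add, hx0, hy0, add_zero, LinearMap.zero_apply]

end Indecomposable

open EvolutionAlgebra

/-! ### The algebras N_{6,25}(α). -/

section N625

variable {K : Type*} [Field K] {α : K}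

theorem N625_mul_apply (x y : N625 α) :
    (x * y) 0 = 0 ∧ (x * y) 1 = x 0 * y 0 + x 3 * y 3 * α ∧
    (x * y) 2 = x 0 * y 0 + x 3 * y 3 * α ∧ (x * y) 3 = 0 ∧
    (x * y) 4 = x 1 * y 1 - x 2 * y 2 ∧ (x * y) 5 = x 3 * y 3 := by
  refine ⟨?_, ?_, ?_, ?_, ?_, ?_⟩ <;>
    simp [EvolutionAlgebra.mul_apply, structureMatrix625, Fin.sum_univ_six, sub_eq_add_neg]

theorem N625_ext {x y : N625 α} (h0 : x 0 = y 0) (h1 : x 1 = y 1) (h2 : x 2 = y 2)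
    (h3 : x 3 = y 3) (h4 : x 4 = y 4) (h5 : x 5 = y 5) : x = y := by
  funext k
  fin_cases k <;> assumption

theorem mul_mul_mul_N625 (x y z w : N625 α) : x * y * z * w = 0 := by
  apply N625_ext <;> simp [N625_mul_apply, EvolutionAlgebra.zero_apply]

theorem not_isDecomposable_N625 (hα : α ≠ 0) : ¬ IsDecomposable K (N625 α) := by
  refine not_isDecomposable_of_forall ((stdBasis (structureMatrix625 α)).coord 0)
    (coord_stdBasis_ne_zero _ 0) ?_
  rintro I J hI hJ hIJ ⟨x, hx, hx0 : x 0 ≠ 0⟩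
  set E := e (structureMatrix625 α) with hE
  have hI' : ∀ {x}, x ∈ I → ∀ y, y * x ∈ I := fun hx y => by rw [mul_comm]; exact hI _ hx y
  have hJ' : ∀ {x}, x ∈ J → ∀ y, y * x ∈ J := fun hx y => by rw [mul_comm]; exact hJ _ hx y
  have hzero : ∀ {x y}, x ∈ I → y ∈ J → x * y = 0 := fun hx hy =>
    mul_eq_zero_of_disjoint hI hJ hIJ.disjoint hx hy
  have h12 : E 1 + E 2 ∈ I := by
    have h : E 0 * x = x 0 • (E 1 + E 2) := by
      apply N625_ext <;> simp [N625_mul_apply, hE, e_apply, EvolutionAlgebra.add_apply,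
        EvolutionAlgebra.smul_apply]
    exact (I.smul_mem_iff hx0).1 (h ▸ hI' hx (E 0))
  have h4 : E 4 ∈ I := by
    have h : E 1 * (E 1 + E 2) = E 4 := by
      apply N625_ext <;> simp [N625_mul_apply, hE, e_apply, EvolutionAlgebra.add_apply]
    exact h ▸ hI' h12 (E 1)
  have hJ4 : ∀ {a : K}, a • E 4 ∈ J → a = 0 := by
    intro a ha
    have := Submodule.disjoint_def.1 hIJ.disjoint _ (I.smul_mem a h4) ha
    simpa [hE, e_apply, EvolutionAlgebra.smul_apply, EvolutionAlgebra.zero_apply] using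
      congrFun this 4
  -- The equation xw = 0 gives x₃w₃ = 0 and then x₀w₀ = 0; the products of w with `E 1` and `E 2`
  -- are multiples of `E 4`, which lies in I.
  have hw0 : ∀ w ∈ J, w 0 = 0 ∧ w 1 = 0 ∧ w 2 = 0 := by
    intro w hw
    have h := hzero hx hw
    have h5 := congrFun h 5
    have h1 := congrFun h 1
    rw [(N625_mul_apply x w).2.2.2.2.2, EvolutionAlgebra.zero_apply] at h5
    rw [(N625_mul_apply x w).2.1, EvolutionAlgebra.zero_apply, h5, zero_mul, add_zero] at h1
    refine ⟨(mul_eq_zero.1 h1).resolve_left hx0, ?_, ?_⟩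
    · refine hJ4 ?_
      have h : E 1 * w = w 1 • E 4 := by
        apply N625_ext <;> simp [N625_mul_apply, hE, e_apply, EvolutionAlgebra.smul_apply]
      exact h ▸ hJ' hw (E 1)
    · refine neg_eq_zero.1 (hJ4 ?_)
      have h : E 2 * w = (-w 2) • E 4 := by
        apply N625_ext <;> simp [N625_mul_apply, hE, e_apply, EvolutionAlgebra.smul_apply]
      exact h ▸ hJ' hw (E 2)
  have hw3 : ∀ w ∈ J, w 3 = 0 := by
    intro w hw
    have h : E 3 * w = w 3 • (α • (E 1 + E 2) + E 5) := by
      apply N625_ext <;> simp [N625_mul_apply, hE, e_apply, EvolutionAlgebra.smul_apply,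
        EvolutionAlgebra.add_apply]
    have h' := (hw0 _ (hJ' hw (E 3))).2.1
    rw [(N625_mul_apply _ _).2.1] at h'
    simpa [hE, e_apply, hα] using h'
  -- Elements of J have no `E 3` coordinate, so the I-component of `E 3` has coordinate 1 there, and
  -- its product with `E 3` is α(`E 1` + `E 2`) + `E 5`.
  have h5 : E 5 ∈ I := by
    obtain ⟨x', hx', y', hy', hxy⟩ :=
      Submodule.mem_sup.1 (hIJ.sup_eq_top ▸ Submodule.mem_top (x := E 3))
    have h3 : x' 3 = 1 := by
      have := congrFun hxy 3
      rw [EvolutionAlgebra.add_apply, hw3 y' hy'] at this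
      simpa [hE, e_apply] using this
    have h : E 3 * x' - α • (E 1 + E 2) = E 5 := by
      apply N625_ext <;> simp [N625_mul_apply, hE, e_apply, EvolutionAlgebra.smul_apply,
        EvolutionAlgebra.add_apply, EvolutionAlgebra.sub_apply, h3]
    exact h ▸ I.sub_mem (hI' hx' _) (I.smul_mem α h12)
  rw [Submodule.eq_bot_iff]
  intro w hw
  refine Submodule.disjoint_def.1 hIJ.disjoint w ?_ hw
  have h : w = w 4 • E 4 + w 5 • E 5 := by
    obtain ⟨h0, h1, h2⟩ := hw0 w hw
    apply N625_ext <;> simp [hE, e_apply, EvolutionAlgebra.smul_apply,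
      EvolutionAlgebra.add_apply, h0, h1, h2, hw3 w hw]
  rw [h]
  exact I.add_mem (I.smul_mem _ h4) (I.smul_mem _ h5)

theorem inClass_N625 (hα : α ≠ 0) : InClass K (N625 α) where
  evolution := isEvolutionAlgebra _
  nil := isNilAlgebra_of_mul_mul_mul mul_mul_mul_N625
  powerAssociative := by
    refine isPowerAssociative_of_sq mul_mul_mul_N625 fun x => ?_
    apply N625_ext <;> simp [N625_mul_apply, EvolutionAlgebra.zero_apply]
  notAssociative h := by
    have := congrFun (h (e _ 0) (e _ 0) (e _ 1)) 4
    rw [(N625_mul_apply _ _).2.2.2.2.1, (N625_mul_apply _ _).2.2.2.2.1] at this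
    simp [N625_mul_apply, e_apply] at this
  indecomposable := not_isDecomposable_N625 hα
  dim_le := (finrank_eq _).le
  dim_annihilator := by
    rw [finrank_annihilator (b := stdBasis (structureMatrix625 α)) (stdBasis_mul_of_ne _)]
    have h : ∀ i, stdBasis (structureMatrix625 α) i * stdBasis (structureMatrix625 α) i = 0 ↔
        i = 4 ∨ i = 5 := by
      intro i
      rw [stdBasis_apply, e_mul_self]
      constructor
      · intro h
        fin_cases i
        · exact absurd (congrFun h 1) (by simp [structureMatrix625, EvolutionAlgebra.zero_apply])
        · exact absurd (congrFun h 4) (by simp [structureMatrix625, EvolutionAlgebra.zero_apply])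
        · exact absurd (congrFun h 4) (by simp [structureMatrix625, EvolutionAlgebra.zero_apply])
        · exact absurd (congrFun h 5) (by simp [structureMatrix625, EvolutionAlgebra.zero_apply])
        · exact Or.inl rfl
        · exact Or.inr rfl
      · rintro (rfl | rfl) <;> funext k <;> fin_cases k <;> rfl
    rw [Nat.card_congr (Equiv.subtypeEquivRight h), Nat.card_eq_fintype_card]
    rfl

theorem HasForm625.apply {d : Module.End K (N625 α)} {E : Fin 6 → N625 α}
    (hE : E = e (structureMatrix625 α)) {d11 d22 d51 d61 d52 d62 d54 d64 : K}
    (h : d (E 0) = d11 • E 0 + d51 • E 4 + d61 • E 5 ∧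
      d (E 1) = d22 • E 1 + (2 * d11 - d22) • E 2 + d52 • E 4 + d62 • E 5 ∧
      d (E 2) = (2 * d11 - d22) • E 1 + d22 • E 2 - d52 • E 4 - d62 • E 5 ∧
      d (E 3) = d11 • E 3 + d54 • E 4 + d64 • E 5 ∧
      d (E 4) = (2 * d22) • E 4 ∧ d (E 5) = (2 * d11) • E 5) (x : N625 α) :
    d x 0 = d11 * x 0 ∧ d x 1 = d22 * x 1 + (2 * d11 - d22) * x 2 ∧
    d x 2 = (2 * d11 - d22) * x 1 + d22 * x 2 ∧ d x 3 = d11 * x 3 ∧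
    d x 4 = d51 * x 0 + d52 * x 1 - d52 * x 2 + d54 * x 3 + 2 * d22 * x 4 ∧
    d x 5 = d61 * x 0 + d62 * x 1 - d62 * x 2 + d64 * x 3 + 2 * d11 * x 5 := by
  subst hE
  obtain ⟨h0, h1, h2, h3, h4, h5⟩ := h
  simp only [apply_eq_sum d x, Fin.sum_univ_six, h0, h1, h2, h3, h4, h5]
  simp [EvolutionAlgebra.add_apply, EvolutionAlgebra.sub_apply, EvolutionAlgebra.smul_apply,
    e_apply]
  refine ⟨?_, ?_, ?_, ?_, ?_, ?_⟩ <;> ring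

theorem HasForm625.mem_derivationAlgebra {d : Module.End K (N625 α)}
    (h : HasForm625 (e (structureMatrix625 α)) d) : d ∈ derivationAlgebra K (N625 α) := by
  obtain ⟨d11, d22, d51, d61, d52, d62, d54, d64, h⟩ := h
  have hd := HasForm625.apply rfl h
  intro x y
  apply N625_ext <;> simp only [N625_mul_apply, hd, EvolutionAlgebra.add_apply] <;> ring

theorem hasForm625_of_mem (h2 : (2 : K) ≠ 0) (hα : α ≠ 0) {d : Module.End K (N625 α)}
    (h : d ∈ derivationAlgebra K (N625 α)) : HasForm625 (e (structureMatrix625 α)) d := by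
  set E := e (structureMatrix625 α) with hE
  -- The Leibniz rule on basis pairs becomes a linear system in `D i k`, the coefficient of `E k` in
  -- d(`E i`). Pairs i ≠ j kill off-diagonal entries, squares relate the others.
  have key : ∀ i j k, ∑ l, (E i * E j) l * d (E l) k = (d (E i) * E j) k + (E i * d (E j)) k :=
    fun i j k => by
      rw [hE, ← apply_eq_sum, ← EvolutionAlgebra.add_apply]
      exact congrFun (h (E i) (E j)) k
  generalize hD : (fun i => d (E i)) = D at *
  have hD' : ∀ i, d (E i) = D i := fun i => congrFun hD i
  simp only [hD', Fin.sum_univ_six] at key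
  have k01 := key 0 1
  have k02 := key 0 2
  have k03 := key 0 3
  have k12 := key 1 2 4
  have k13 := key 1 3
  have k23 := key 2 3
  have k00 := key 0 0
  have k11 := key 1 1
  have k22 := key 2 2 4
  have k33 := key 3 3
  have k15 := key 1 5 4
  have k25 := key 2 5 4
  simp [Fin.forall_fin_succ, N625_mul_apply, hE, e_apply]
    at k01 k02 k03 k12 k13 k23 k00 k11 k22 k33 k15 k25
  obtain ⟨d10, d01⟩ := k01
  obtain ⟨d20, d02⟩ := k02
  obtain ⟨d30, d03⟩ := k03
  obtain ⟨-, d31, d13⟩ := k13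
  obtain ⟨-, d32, d23⟩ := k23
  obtain ⟨-, k1, k2, -, k4, k5⟩ := k00
  obtain ⟨d40, d41, d42, d43, d44, d45⟩ := k11
  obtain ⟨d50, k6, -, d53, d54, d55⟩ := k33
  rw [← d03, zero_mul, zero_add] at d30
  rw [← d10, ← d20, mul_zero, zero_add, zero_add] at d50
  rw [← d13, ← d23, mul_zero, zero_add, zero_add] at d53
  rw [← mul_add, k4, mul_zero, zero_add] at d54
  rw [← mul_add, k5, mul_zero, zero_add] at d55
  have d22 : D 2 2 = D 1 1 := mul_left_cancel₀ h2 (by linear_combination d44 + k22)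
  -- Comparing the `E 1` coordinates for the squares of `E 0` and `E 3` gives 2α `D 3 3` = 2α `D 0
  -- 0`.
  have d33 : D 3 3 = D 0 0 :=
    mul_left_cancel₀ (mul_ne_zero h2 hα) (by linear_combination -k6 + α * k1 - k15)
  have d21 : D 2 1 = 2 * D 0 0 - D 1 1 := by linear_combination k1
  have d12 : D 1 2 = 2 * D 0 0 - D 1 1 := by linear_combination k2 - d22
  have d24 : D 2 4 = -D 1 4 := by linear_combination k4
  have d25 : D 2 5 = -D 1 5 := by linear_combination k5
  rw [d33, ← two_mul] at d55
  rw [← two_mul] at d44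
  refine ⟨D 0 0, D 1 1, D 0 4, D 0 5, D 1 4, D 1 5, D 3 4, D 3 5, ?_, ?_, ?_, ?_, ?_, ?_⟩ <;>
    rw [hD'] <;> apply N625_ext <;>
    simp [hE, e_apply, EvolutionAlgebra.add_apply, EvolutionAlgebra.sub_apply,
      EvolutionAlgebra.smul_apply, ← d01, d02, ← d03, ← d10, ← d13, ← d20, ← d23, ← d30, ← d31,
      d32, d40, d41, d42, d43, d45, d50, ← k15, k25, d53, d54, d55, d44, d33, d22, d21, d12, d24,
      d25]

theorem mem_derivationAlgebra_N625 (h2 : (2 : K) ≠ 0) (hα : α ≠ 0) (d : Module.End K (N625 α)) :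
    d ∈ derivationAlgebra K (N625 α) ↔ HasForm625 (e (structureMatrix625 α)) d :=
  ⟨hasForm625_of_mem h2 hα, HasForm625.mem_derivationAlgebra⟩

theorem nonempty_derivationAlgebra_N625_equiv (h2 : (2 : K) ≠ 0) (hα : α ≠ 0) :
    Nonempty (derivationAlgebra K (N625 α) ≃ₗ[K] (Fin 5 → K) × (Fin 3 → K)) := by
  set E := e (structureMatrix625 α) with hE
  -- `g` reads off the eight free parameters d51, d61, d52, d62, d54 and d64, d11, d22; surjectivity
  -- builds d from its values on the basis.
  let g : derivationAlgebra K (N625 α) →ₗ[K] (Fin 5 → K) × (Fin 3 → K) :=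
    { toFun := fun d => (![d.1 (E 0) 4, d.1 (E 0) 5, d.1 (E 1) 4, d.1 (E 1) 5, d.1 (E 3) 4],
        ![d.1 (E 3) 5, d.1 (E 0) 0, d.1 (E 1) 1])
      map_add' := fun d d' => by
        refine Prod.ext ?_ ?_ <;> funext k <;> fin_cases k <;> rfl
      map_smul' := fun c d => by
        refine Prod.ext ?_ ?_ <;> funext k <;> fin_cases k <;> rfl }
  refine ⟨LinearEquiv.ofBijective g ⟨?_, ?_⟩⟩
  · rw [← LinearMap.ker_eq_bot, Submodule.eq_bot_iff]
    rintro ⟨d, hd⟩ hg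
    obtain ⟨d11, d22, d51, d61, d52, d62, d54, d64, h⟩ := hasForm625_of_mem h2 hα hd
    have hd' := HasForm625.apply rfl h
    obtain ⟨hg1, hg2⟩ := Prod.ext_iff.1 (LinearMap.mem_ker.1 hg)
    have g1 := fun k => congrFun hg1 k
    have g2 := fun k => congrFun hg2 k
    simp [Fin.forall_fin_succ, g, hd', hE, e_apply] at g1 g2
    obtain ⟨g51, g61, g52, g62, g54⟩ := g1
    obtain ⟨g64, g11, g22⟩ := g2
    refine Subtype.ext (LinearMap.ext fun x => ?_)
    apply N625_ext <;>
      simp [hd', g11, g22, g51, g61, g52, g62, g54, g64, EvolutionAlgebra.zero_apply]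
  · rintro ⟨p, q⟩
    let T : Fin 6 → N625 α :=
      ![q 1 • E 0 + p 0 • E 4 + p 1 • E 5,
        q 2 • E 1 + (2 * q 1 - q 2) • E 2 + p 2 • E 4 + p 3 • E 5,
        (2 * q 1 - q 2) • E 1 + q 2 • E 2 - p 2 • E 4 - p 3 • E 5,
        q 1 • E 3 + p 4 • E 4 + q 0 • E 5, (2 * q 2) • E 4, (2 * q 1) • E 5]
    let d : Module.End K (N625 α) := (stdBasis (structureMatrix625 α)).constr K T
    have hd : ∀ i, d (E i) = T i := fun i => by
      rw [hE, ← stdBasis_apply]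
      exact (stdBasis (structureMatrix625 α)).constr_basis K T i
    have h := And.intro (hd 0) (And.intro (hd 1) (And.intro (hd 2) (And.intro (hd 3)
      (And.intro (hd 4) (hd 5)))))
    have hd' := HasForm625.apply (d11 := q 1) (d22 := q 2) (d51 := p 0) (d61 := p 1) (d52 := p 2)
      (d62 := p 3) (d54 := p 4) (d64 := q 0) hE h
    refine ⟨⟨d, HasForm625.mem_derivationAlgebra ⟨q 1, q 2, p 0, p 1, p 2, p 3, p 4, q 0, h⟩⟩, ?_⟩
    refine Prod.ext ?_ ?_ <;> funext k <;> fin_cases k <;> simp [g, hd', hE, e_apply]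

end N625

/-! ### The algebra N_{6,26}. -/

section N626

variable {K : Type*} [Field K]

theorem N626_mul_apply (x y : N626 K) :
    (x * y) 0 = 0 ∧ (x * y) 1 = x 0 * y 0 ∧ (x * y) 2 = x 0 * y 0 ∧ (x * y) 3 = x 0 * y 0 ∧
    (x * y) 4 = x 1 * y 1 - x 3 * y 3 ∧ (x * y) 5 = x 2 * y 2 - x 3 * y 3 := by
  refine ⟨?_, ?_, ?_, ?_, ?_, ?_⟩ <;>
    simp [EvolutionAlgebra.mul_apply, structureMatrix626, Fin.sum_univ_six, sub_eq_add_neg]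

theorem N626_ext {x y : N626 K} (h0 : x 0 = y 0) (h1 : x 1 = y 1) (h2 : x 2 = y 2)
    (h3 : x 3 = y 3) (h4 : x 4 = y 4) (h5 : x 5 = y 5) : x = y := by
  funext k
  fin_cases k <;> assumption

theorem mul_mul_mul_N626 (x y z w : N626 K) : x * y * z * w = 0 := by
  apply N626_ext <;> simp [N626_mul_apply, EvolutionAlgebra.zero_apply]

theorem not_isDecomposable_N626 : ¬ IsDecomposable K (N626 K) := by
  refine not_isDecomposable_of_forall ((stdBasis (structureMatrix626 K)).coord 0)
    (coord_stdBasis_ne_zero _ 0) ?_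
  rintro I J hI hJ hIJ ⟨x, hx, hx0 : x 0 ≠ 0⟩
  set E := e (structureMatrix626 K) with hE
  have hI' : ∀ {x}, x ∈ I → ∀ y, y * x ∈ I := fun hx y => by rw [mul_comm]; exact hI _ hx y
  have hJ' : ∀ {x}, x ∈ J → ∀ y, y * x ∈ J := fun hx y => by rw [mul_comm]; exact hJ _ hx y
  have hzero : ∀ {x y}, x ∈ I → y ∈ J → x * y = 0 := fun hx hy =>
    mul_eq_zero_of_disjoint hI hJ hIJ.disjoint hx hy
  have h123 : E 1 + E 2 + E 3 ∈ I := by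
    have h : E 0 * x = x 0 • (E 1 + E 2 + E 3) := by
      apply N626_ext <;> simp [N626_mul_apply, hE, e_apply, EvolutionAlgebra.add_apply,
        EvolutionAlgebra.smul_apply]
    exact (I.smul_mem_iff hx0).1 (h ▸ hI' hx (E 0))
  have h4 : E 4 ∈ I := by
    have h : E 1 * (E 1 + E 2 + E 3) = E 4 := by
      apply N626_ext <;> simp [N626_mul_apply, hE, e_apply, EvolutionAlgebra.add_apply]
    exact h ▸ hI' h123 (E 1)
  have h5 : E 5 ∈ I := by
    have h : E 2 * (E 1 + E 2 + E 3) = E 5 := by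
      apply N626_ext <;> simp [N626_mul_apply, hE, e_apply, EvolutionAlgebra.add_apply]
    exact h ▸ hI' h123 (E 2)
  rw [Submodule.eq_bot_iff]
  intro w hw
  have hw0 : w 0 = 0 := by
    have h := congrFun (hzero hx hw) 1
    rw [(N626_mul_apply x w).2.1, EvolutionAlgebra.zero_apply] at h
    exact (mul_eq_zero.1 h).resolve_left hx0
  have hw1 : w 1 = 0 := by
    have h : E 1 * w = w 1 • E 4 := by
      apply N626_ext <;> simp [N626_mul_apply, hE, e_apply, EvolutionAlgebra.smul_apply]
    have := Submodule.disjoint_def.1 hIJ.disjoint _ (I.smul_mem (w 1) h4) (h ▸ hJ' hw (E 1))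
    simpa [hE, e_apply, EvolutionAlgebra.smul_apply, EvolutionAlgebra.zero_apply] using
      congrFun this 4
  -- Coordinates 4 and 5 of this product are w₁ - w₃ and w₂ - w₃, so w₁ = 0 forces w₃ = w₂ = 0.
  have hw123 := hzero h123 hw
  have hw3 : w 3 = 0 := by
    have := congrFun hw123 4
    rw [(N626_mul_apply _ w).2.2.2.2.1, EvolutionAlgebra.zero_apply] at this
    simpa [hE, e_apply, EvolutionAlgebra.add_apply, hw1] using this
  have hw2 : w 2 = 0 := by
    have := congrFun hw123 5
    rw [(N626_mul_apply _ w).2.2.2.2.2, EvolutionAlgebra.zero_apply] at this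
    simpa [hE, e_apply, EvolutionAlgebra.add_apply, hw3] using this
  refine Submodule.disjoint_def.1 hIJ.disjoint w ?_ hw
  have h : w = w 4 • E 4 + w 5 • E 5 := by
    apply N626_ext <;> simp [hE, e_apply, EvolutionAlgebra.smul_apply,
      EvolutionAlgebra.add_apply, hw0, hw1, hw2, hw3]
  rw [h]
  exact I.add_mem (I.smul_mem _ h4) (I.smul_mem _ h5)

theorem inClass_N626 : InClass K (N626 K) where
  evolution := isEvolutionAlgebra _
  nil := isNilAlgebra_of_mul_mul_mul mul_mul_mul_N626
  powerAssociative := by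
    refine isPowerAssociative_of_sq mul_mul_mul_N626 fun x => ?_
    apply N626_ext <;> simp [N626_mul_apply, EvolutionAlgebra.zero_apply]
  notAssociative h := by
    have := congrFun (h (e _ 0) (e _ 0) (e _ 1)) 4
    rw [(N626_mul_apply _ _).2.2.2.2.1, (N626_mul_apply _ _).2.2.2.2.1] at this
    simp [N626_mul_apply, e_apply] at this
  indecomposable := not_isDecomposable_N626
  dim_le := (finrank_eq _).le
  dim_annihilator := by
    rw [finrank_annihilator (b := stdBasis (structureMatrix626 K)) (stdBasis_mul_of_ne _)]
    have h : ∀ i, stdBasis (structureMatrix626 K) i * stdBasis (structureMatrix626 K) i = 0 ↔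
        i = 4 ∨ i = 5 := by
      intro i
      rw [stdBasis_apply, e_mul_self]
      constructor
      · intro h
        fin_cases i
        · exact absurd (congrFun h 1) (by simp [structureMatrix626, EvolutionAlgebra.zero_apply])
        · exact absurd (congrFun h 4) (by simp [structureMatrix626, EvolutionAlgebra.zero_apply])
        · exact absurd (congrFun h 5) (by simp [structureMatrix626, EvolutionAlgebra.zero_apply])
        · exact absurd (congrFun h 5) (by simp [structureMatrix626, EvolutionAlgebra.zero_apply])
        · exact Or.inl rfl
        · exact Or.inr rfl
      · rintro (rfl | rfl) <;> funext k <;> fin_cases k <;> rfl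
    rw [Nat.card_congr (Equiv.subtypeEquivRight h), Nat.card_eq_fintype_card]
    rfl

theorem HasForm626.apply {d : Module.End K (N626 K)} {E : Fin 6 → N626 K}
    (hE : E = e (structureMatrix626 K)) {d11 d51 d61 d52 d62 d53 d63 : K}
    (h : d (E 0) = d11 • E 0 + d51 • E 4 + d61 • E 5 ∧
      d (E 1) = (2 * d11) • E 1 + d52 • E 4 + d62 • E 5 ∧
      d (E 2) = (2 * d11) • E 2 + d53 • E 4 + d63 • E 5 ∧
      d (E 3) = (2 * d11) • E 3 - (d52 + d53) • E 4 - (d62 + d63) • E 5 ∧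
      d (E 4) = (4 * d11) • E 4 ∧ d (E 5) = (4 * d11) • E 5) (x : N626 K) :
    d x 0 = d11 * x 0 ∧ d x 1 = 2 * d11 * x 1 ∧ d x 2 = 2 * d11 * x 2 ∧
    d x 3 = 2 * d11 * x 3 ∧
    d x 4 = d51 * x 0 + d52 * x 1 + d53 * x 2 - (d52 + d53) * x 3 + 4 * d11 * x 4 ∧
    d x 5 = d61 * x 0 + d62 * x 1 + d63 * x 2 - (d62 + d63) * x 3 + 4 * d11 * x 5 := by
  subst hE
  obtain ⟨h0, h1, h2, h3, h4, h5⟩ := h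
  simp only [apply_eq_sum d x, Fin.sum_univ_six, h0, h1, h2, h3, h4, h5]
  simp [EvolutionAlgebra.add_apply, EvolutionAlgebra.sub_apply, EvolutionAlgebra.smul_apply,
    e_apply]
  refine ⟨?_, ?_, ?_, ?_, ?_, ?_⟩ <;> ring

theorem HasForm626.mem_derivationAlgebra {d : Module.End K (N626 K)}
    (h : HasForm626 (e (structureMatrix626 K)) d) : d ∈ derivationAlgebra K (N626 K) := by
  obtain ⟨d11, d51, d61, d52, d62, d53, d63, h⟩ := h
  have hd := HasForm626.apply rfl h
  intro x y
  apply N626_ext <;> simp only [N626_mul_apply, hd, EvolutionAlgebra.add_apply] <;> ring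

theorem hasForm626_of_mem {d : Module.End K (N626 K)}
    (h : d ∈ derivationAlgebra K (N626 K)) : HasForm626 (e (structureMatrix626 K)) d := by
  set E := e (structureMatrix626 K) with hE
  have key : ∀ i j k, ∑ l, (E i * E j) l * d (E l) k = (d (E i) * E j) k + (E i * d (E j)) k :=
    fun i j k => by
      rw [hE, ← apply_eq_sum, ← EvolutionAlgebra.add_apply]
      exact congrFun (h (E i) (E j)) k
  generalize hD : (fun i => d (E i)) = D at *
  have hD' : ∀ i, d (E i) = D i := fun i => congrFun hD i
  simp only [hD', Fin.sum_univ_six] at key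
  have k01 := key 0 1
  have k02 := key 0 2
  have k03 := key 0 3
  have k12 := key 1 2
  have k13 := key 1 3
  have k23 := key 2 3
  have k00 := key 0 0
  have k11 := key 1 1
  have k22 := key 2 2
  simp [Fin.forall_fin_succ, N626_mul_apply, hE, e_apply]
    at k01 k02 k03 k12 k13 k23 k00 k11 k22
  obtain ⟨d10, d01⟩ := k01
  obtain ⟨d20, d02⟩ := k02
  obtain ⟨d30, d03⟩ := k03
  obtain ⟨d21, d12⟩ := k12
  obtain ⟨d31, d13⟩ := k13
  obtain ⟨d23, d32⟩ := k23
  obtain ⟨-, k1, k2, k3, k4, k5⟩ := k00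
  obtain ⟨d40, d41, d42, d43, d44, d45⟩ := k11
  obtain ⟨d50, d51, d52, d53, d54, d55⟩ := k22
  rw [d13, neg_zero, zero_add] at d31
  rw [d23, neg_zero, zero_add] at d32
  -- The square of `E 0` gives column sums equal to 2 `D 0 0`; the off-diagonal entries among `E 1`,
  -- `E 2`, `E 3` are zero.
  have d11 : D 1 1 = 2 * D 0 0 := by linear_combination k1 + d21 + d31
  have d22 : D 2 2 = 2 * D 0 0 := by linear_combination k2 + d12 + d32
  have d33 : D 3 3 = 2 * D 0 0 := by linear_combination k3 - d13 - d23
  have d34 : D 3 4 = -(D 1 4 + D 2 4) := by linear_combination k4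
  have d35 : D 3 5 = -(D 1 5 + D 2 5) := by linear_combination k5
  have d44' : D 4 4 = 4 * D 0 0 := by linear_combination d44 + 2 * d11
  have d55' : D 5 5 = 4 * D 0 0 := by linear_combination d55 + 2 * d22
  refine ⟨D 0 0, D 0 4, D 0 5, D 1 4, D 1 5, D 2 4, D 2 5, ?_, ?_, ?_, ?_, ?_, ?_⟩ <;>
    rw [hD'] <;> apply N626_ext <;>
    simp [hE, e_apply, EvolutionAlgebra.add_apply, EvolutionAlgebra.sub_apply,
      EvolutionAlgebra.smul_apply, ← d01, ← d02, d03, ← d10, ← d12, d13, ← d20, ← d21, d23, ← d30,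
      ← d31, ← d32, d40, d41, d42, d43, d45, d50, d51, d52, d53, d54, d11, d22, d33, d34, d35,
      d44', d55']

theorem mem_derivationAlgebra_N626 (d : Module.End K (N626 K)) :
    d ∈ derivationAlgebra K (N626 K) ↔ HasForm626 (e (structureMatrix626 K)) d :=
  ⟨hasForm626_of_mem, HasForm626.mem_derivationAlgebra⟩

theorem nonempty_derivationAlgebra_N626_equiv :
    Nonempty (derivationAlgebra K (N626 K) ≃ₗ[K] (Fin 4 → K) × (Fin 3 → K)) := by
  set E := e (structureMatrix626 K) with hE
  let g : derivationAlgebra K (N626 K) →ₗ[K] (Fin 4 → K) × (Fin 3 → K) :=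
    { toFun := fun d => (![d.1 (E 0) 4, d.1 (E 0) 5, d.1 (E 1) 4, d.1 (E 1) 5],
        ![d.1 (E 2) 4, d.1 (E 2) 5, d.1 (E 0) 0])
      map_add' := fun d d' => by
        refine Prod.ext ?_ ?_ <;> funext k <;> fin_cases k <;> rfl
      map_smul' := fun c d => by
        refine Prod.ext ?_ ?_ <;> funext k <;> fin_cases k <;> rfl }
  refine ⟨LinearEquiv.ofBijective g ⟨?_, ?_⟩⟩
  · rw [← LinearMap.ker_eq_bot, Submodule.eq_bot_iff]
    rintro ⟨d, hd⟩ hg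
    obtain ⟨d11, d51, d61, d52, d62, d53, d63, h⟩ := hasForm626_of_mem hd
    have hd' := HasForm626.apply rfl h
    obtain ⟨hg1, hg2⟩ := Prod.ext_iff.1 (LinearMap.mem_ker.1 hg)
    have g1 := fun k => congrFun hg1 k
    have g2 := fun k => congrFun hg2 k
    simp [Fin.forall_fin_succ, g, hd', hE, e_apply] at g1 g2
    obtain ⟨g51, g61, g52, g62⟩ := g1
    obtain ⟨g53, g63, g11⟩ := g2
    refine Subtype.ext (LinearMap.ext fun x => ?_)
    apply N626_ext <;>
      simp [hd', g11, g51, g61, g52, g62, g53, g63, EvolutionAlgebra.zero_apply]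
  · rintro ⟨p, q⟩
    let T : Fin 6 → N626 K :=
      ![q 2 • E 0 + p 0 • E 4 + p 1 • E 5, (2 * q 2) • E 1 + p 2 • E 4 + p 3 • E 5,
        (2 * q 2) • E 2 + q 0 • E 4 + q 1 • E 5,
        (2 * q 2) • E 3 - (p 2 + q 0) • E 4 - (p 3 + q 1) • E 5, (4 * q 2) • E 4, (4 * q 2) • E 5]
    let d : Module.End K (N626 K) := (stdBasis (structureMatrix626 K)).constr K T
    have hd : ∀ i, d (E i) = T i := fun i => by
      rw [hE, ← stdBasis_apply]
      exact (stdBasis (structureMatrix626 K)).constr_basis K T i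
    have h := And.intro (hd 0) (And.intro (hd 1) (And.intro (hd 2) (And.intro (hd 3)
      (And.intro (hd 4) (hd 5)))))
    have hd' := HasForm626.apply (d11 := q 2) (d51 := p 0) (d61 := p 1) (d52 := p 2)
      (d62 := p 3) (d53 := q 0) (d63 := q 1) hE h
    refine ⟨⟨d, HasForm626.mem_derivationAlgebra ⟨q 2, p 0, p 1, p 2, p 3, q 0, q 1, h⟩⟩, ?_⟩
    refine Prod.ext ?_ ?_ <;> funext k <;> fin_cases k <;> simp [g, hd', hE, e_apply]

end N626

end EvolutionNil

open EvolutionNil EvolutionAlgebra in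
theorem mainTheorem6 {K : Type*} [Field K] (hK : ringChar K ≠ 2) :
    -- every algebra of the class is one of the algebras of the table
    (∀ (N : Type*) [NonUnitalNonAssocCommRing N] [Module K N] [IsScalarTower K N N]
        [SMulCommClass K N N], InClass K N →
        (∃ α : K, α ≠ 0 ∧ AlgebraIsomorphic K N (N625 α)) ∨ AlgebraIsomorphic K N (N626 K)) ∧
    -- the row of `N_{6,25}(α)`
    (∀ α : K, α ≠ 0 →
      InClass K (N625 α) ∧
      (∀ d : Module.End K (N625 α),
        d ∈ derivationAlgebra K (N625 α) ↔ HasForm625 (e (structureMatrix625 α)) d) ∧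
      Nonempty (derivationAlgebra K (N625 α) ≃ₗ[K] (Fin 5 → K) × (Fin 3 → K))) ∧
    -- the row of `N_{6,26}`
    InClass K (N626 K) ∧
    (∀ d : Module.End K (N626 K),
      d ∈ derivationAlgebra K (N626 K) ↔ HasForm626 (e (structureMatrix626 K)) d) ∧
    Nonempty (derivationAlgebra K (N626 K) ≃ₗ[K] (Fin 4 → K) × (Fin 3 → K)) := by
  have h2 : (2 : K) ≠ 0 := Ring.two_ne_zero hK
  exact ⟨fun N _ _ _ _ h => h.classification h2,
    fun α hα => ⟨inClass_N625 hα, mem_derivationAlgebra_N625 h2 hα,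
      nonempty_derivationAlgebra_N625_equiv h2 hα⟩,
    inClass_N626, mem_derivationAlgebra_N626, nonempty_derivationAlgebra_N626_equiv⟩
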